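/- Let $R$ be a commutative Noetherian ring, let $n\ge 0$ be an integer, and let $M$, $N$ be finitely generated $R$-modules. All modules below are finitely generated. **Definitions.** The grade of a module $X$ is $\operatorname{grade}X=\inf\{i\mid \operatorname{Ext}^i_R(X,R)\ne 0\}$ (it is $\infty$ for $X=0$). A module $K$ is *semidualizing* if the homothety map $R\to\operatorname{Hom}_R(K,K)$ is an isomorphism and $\operatorname{Ext}^i_R(K,K)=0$ for all $i>0$. A module $G$ is *totally $K$-reflexive* if the evaluation map $G\to\operatorname{Hom}_R(\operatorname{Hom}_R(G,K),K)$ is bijective and $\operatorname{Ext}^i_R(G,K)=0=\operatorname{Ext}^i_R(\operatorname{Hom}_R(G,K),K)$ for all $i>0$. The dimension $\mathrm{G}_K\text{-}\dim_R X\in\mathbb N\cup\{\infty\}$ is the least $m$ for which there is an exact sequence $0\to G_m\to\cdots\to G_0\to X\to0$ with all $G_i$ totally $K$-reflexive. Let $\mathrm{G}^n_K(\mathcal P)$ be the class of *$\mathrm{G}_K$-perfect modules of grade $n$*, i.e. of modules $X$ with $\operatorname{grade}X=\mathrm{G}_K\text{-}\dim_R X=n$, and let $\mathcal P^n(R)$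 be the class of *perfect modules of grade $n$*, i.e. of modules $X$ with $\operatorname{grade}X=\operatorname{pd}_RX=n$. Let $K$ be a semidualizing module and let $\mathcal X$ be either $\mathrm{G}^n_K(\mathcal P)$, or $\mathcal P^n(R)$ with $K=R$. Let $\operatorname{Epi}(\mathcal X)$ be the class of surjective homomorphisms $\phi:X\to L$ with $X\in\mathcal X$ and $\operatorname{grade}L=\operatorname{grade}X$. For such $\phi$, with inclusion $j:\ker\phi\to X$, let $\mathcal L^n_K(\phi):\operatorname{Ext}^n_R(X,K)\to\operatorname{im}\operatorname{Ext}^n_R(j,K)$ be the surjection induced by $\operatorname{Ext}^n_R(j,K)$. Write $\phi\equiv\psi$ for homomorphisms $\phi:X\to L$, $\psi:Y\to L'$ if there are isomorphisms $\alpha:L\to L'$, $\beta:X\to Y$ with $\alpha\phi=\psi\beta$. Modules $L$, $L'$ are *linked in one step* with respect to $\mathcal X$ if there are $\phi:X\to L$ and $\psi:Y\to L'$ in $\operatorname{Epi}(\mathcal X)$ with $\phi\equiv\mathcal L^n_K(\psi)$ and $\psi\equiv\mathcal L^n_K(\phi)$. They are *evenly linked* if they are joined by a chain of $m$ one-step links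 for some even $m>0$. The *even liaison classes* with respect to $\mathcal X$ are the classes of the equivalence relation generated by even linkage. If $(S,\mathfrak n)$ is a Noetherian local ring, a *quasi-deformation* of $S$ is a diagram $S\to S'\leftarrow Q$ of local homomorphisms of Noetherian local rings in which $S\to S'$ is flat and $Q\to S'$ is surjective with kernel generated by a $Q$-regular sequence. For an $S$-module $X\ne0$ put $\operatorname{CI-dim}_SX=\inf\{\operatorname{pd}_Q(X\otimes_SS')-\operatorname{pd}_QS'\}$, the infimum being over all quasi-deformations of $S$, and put $\operatorname{CI-dim}_S0=0$. For an $R$-module $X$ put $\operatorname{CI-dim}_RX=\sup_{\mathfrak m}\operatorname{CI-dim}_{R_{\mathfrak m}}X_{\mathfrak m}$, where $\mathfrak m$ runs over the maximal ideals of $R$. **Theorem.** (i) Let $K$ be a semidualizing $R$-module. If $M$ and $N$ are in the same even liaison class with respect to $\mathrm{G}^n_K(\mathcal P)$, then $\operatorname{Ext}^i_R(M,K)\cong\operatorname{Ext}^i_R(N,K)$ as $R$-modules for all $i>n$. Moreover, $\mathrm{G}_K\text{-}\dim_RM=\mathrm{G}_K\text{-}\dim_RN$. (ii) If $M$ and $N$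 are in the same even liaison class with respect to $\mathcal P^n(R)$ (with $K=R$), then $\operatorname{pd}_RM=\operatorname{pd}_RN$. Moreover, $\operatorname{CI-dim}_RM=\operatorname{CI-dim}_RN$. -/

import Mathlib

open CategoryTheory CategoryTheory.Abelian

universe u

namespace ModuleLinkage

variable {R : Type u} [CommRing R]

/-! ### Grade, semidualizing modules and Gorenstein dimension with respect to them -/

/-- The grade of a module: the least `i` with `Ext^i(M, R) ≠ 0`, and `⊤` if there is none
(in particular for the zero module). -/
noncomputable def grade (M : ModuleCat.{u} R) : ℕ∞ :=
  ⨅ (i : ℕ) (_ : Nontrivial (Ext M (ModuleCat.of R R) i)), (i : ℕ∞)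

/-- Semidualizing modules: finitely generated, the homothety map `R → Hom(K, K)` is bijective,
and `Ext^i(K, K) = 0` for `i > 0`. -/
structure IsSemidualizing (K : ModuleCat.{u} R) : Prop where
  finite : Module.Finite R K
  homothety_bijective : Function.Bijective (LinearMap.lsmul R K)
  ext_eq_zero : ∀ i : ℕ, 0 < i → Subsingleton (Ext K K i)

/-- The `K`-dual `Hom(M, K)`. -/
abbrev kDual (K M : ModuleCat.{u} R) : ModuleCat.{u} R :=
  ModuleCat.of R (M →ₗ[R] K)

/-- Totally `K`-reflexive modules; `LinearMap.applyₗ` is the evaluation map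
`G → Hom(Hom(G, K), K)`. -/
structure IsTotallyReflexive (K G : ModuleCat.{u} R) : Prop where
  finite : Module.Finite R G
  eval_bijective :
    Function.Bijective (LinearMap.applyₗ : G →ₗ[R] (G →ₗ[R] K) →ₗ[R] K)
  ext_eq_zero : ∀ i : ℕ, 0 < i → Subsingleton (Ext G K i)
  ext_dual_eq_zero : ∀ i : ℕ, 0 < i → Subsingleton (Ext (kDual K G) K i)

/-- There is an exact sequence `0 → G_m → ⋯ → G_1 → G_0 → M → 0` with every `G_i` totally
`K`-reflexive. -/
def HasGKResolution (K M : ModuleCat.{u} R) (m : ℕ) : Prop :=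
  ∃ (G : ℕ → ModuleCat.{u} R) (d : ∀ i, G (i + 1) →ₗ[R] G i) (ε : G 0 →ₗ[R] M),
    (∀ i, i ≤ m → IsTotallyReflexive K (G i)) ∧
    (∀ i, m < i → Subsingleton (G i)) ∧
    Function.Surjective ε ∧
    Function.Exact (d 0) ε ∧
    ∀ i, Function.Exact (d (i + 1)) (d i)

/-- The `G_K`-dimension: the least length of a resolution by totally `K`-reflexive modules,
`⊤` if there is no such resolution of finite length. -/
noncomputable def gkDim (K M : ModuleCat.{u} R) : ℕ∞ :=
  ⨅ (m : ℕ) (_ : HasGKResolution K M m), (m : ℕ∞)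

/-- The subcategory of `G_K`-perfect modules of grade `n`. -/
def gkPerfect (K : ModuleCat.{u} R) (n : ℕ) : ObjectProperty (ModuleCat.{u} R) :=
  fun M => Module.Finite R M ∧ grade M = n ∧ gkDim K M = n

/-- The subcategory of perfect modules of grade `n`. -/
def perfect (n : ℕ) : ObjectProperty (ModuleCat.{u} R) :=
  fun M => Module.Finite R M ∧ grade M = n ∧ projectiveDimension M = n

/-! ### Linkage by reflexive homomorphisms -/

/-- The homomorphism `Ext^n(f, K) : Ext^n(B, K) → Ext^n(A, K)` induced by `f : A → B`. -/
noncomputable def extMap (K : ModuleCat.{u} R) (n : ℕ) {A B : ModuleCat.{u} R} (f : A ⟶ B) :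
    Ext B K n →ₗ[R] Ext A K n :=
  (Ext.mk₀ f).precompOfLinear R K (zero_add n)

/-- The inclusion of the kernel of `φ`. -/
def kerIncl {X M : ModuleCat.{u} R} (φ : X ⟶ M) :
    ModuleCat.of R (LinearMap.ker φ.hom) ⟶ X :=
  ModuleCat.ofHom (LinearMap.ker φ.hom).subtype

/-- The operator `L_K^n`: for `φ : X → M` and the inclusion `j : ker φ → X`, the epimorphism
from `Ext^n(X, K)` onto the image of `Ext^n(j, K)`. -/
noncomputable def linkHom (K : ModuleCat.{u} R) (n : ℕ) {X M : ModuleCat.{u} R} (φ : X ⟶ M) :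
    ModuleCat.of R (Ext X K n) ⟶ ModuleCat.of R (LinearMap.range (extMap K n (kerIncl φ))) :=
  ModuleCat.ofHom (extMap K n (kerIncl φ)).rangeRestrict

/-- The set `Epi(𝒳)`: epimorphisms `φ : X → M` with `X` in `𝒳`, `M` finitely generated and
`grade M = grade X`. -/
structure MemEpi (𝒳 : ObjectProperty (ModuleCat.{u} R)) {X M : ModuleCat.{u} R}
    (φ : X ⟶ M) : Prop where
  source_mem : 𝒳 X
  finite : Module.Finite R M
  surjective : Function.Surjective φ.hom
  grade_eq : grade M = grade X

/-- Equivalence of homomorphisms: an isomorphism of sources and an isomorphism of targets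
forming a commutative square. -/
def HomEquiv {X M Y N : ModuleCat.{u} R} (φ : X ⟶ M) (ψ : Y ⟶ N) : Prop :=
  ∃ (α : M ≅ N) (β : X ≅ Y), φ ≫ α.hom = β.hom ≫ ψ

/-- `M` and `N` are linked in one step with respect to `𝒳` (an `n`-reflexive subcategory with
respect to `K`): there are `φ : X → M` and `ψ : Y → N` in `Epi(𝒳)` with `φ ≡ L_K^n(ψ)` and
`ψ ≡ L_K^n(φ)`. -/
def DirectlyLinked (K : ModuleCat.{u} R) (n : ℕ) (𝒳 : ObjectProperty (ModuleCat.{u} R))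
    (M N : ModuleCat.{u} R) : Prop :=
  ∃ (X Y : ModuleCat.{u} R) (φ : X ⟶ M) (ψ : Y ⟶ N),
    MemEpi 𝒳 φ ∧ MemEpi 𝒳 ψ ∧
    HomEquiv φ (linkHom K n ψ) ∧ HomEquiv ψ (linkHom K n φ)

/-- `M` and `N` are linked in `m` steps. -/
def LinkedInSteps (K : ModuleCat.{u} R) (n : ℕ) (𝒳 : ObjectProperty (ModuleCat.{u} R))
    (m : ℕ) (M N : ModuleCat.{u} R) : Prop :=
  ∃ L : ℕ → ModuleCat.{u} R, L 0 = M ∧ L m = N ∧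
    ∀ i, i < m → DirectlyLinked K n 𝒳 (L i) (L (i + 1))

/-- `M` and `N` are evenly linked: linked in a positive even number of steps. -/
def EvenlyLinked (K : ModuleCat.{u} R) (n : ℕ) (𝒳 : ObjectProperty (ModuleCat.{u} R))
    (M N : ModuleCat.{u} R) : Prop :=
  ∃ m : ℕ, 0 < m ∧ Even m ∧ LinkedInSteps K n 𝒳 m M N

/-- `M` and `N` are in the same even liaison class: even liaison is the equivalence relation
generated by even linkage. -/
def SameEvenLiaisonClass (K : ModuleCat.{u} R) (n : ℕ) (𝒳 : ObjectProperty (ModuleCat.{u} R))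
    (M N : ModuleCat.{u} R) : Prop :=
  Relation.EqvGen (EvenlyLinked K n 𝒳) M N

/-! ### Complete intersection dimension -/

/-- A quasi-deformation `R → R' ← Q` of a local ring `R`: local homomorphisms of Noetherian
local rings, the first one flat, the second one surjective with kernel generated by a
`Q`-regular sequence. -/
structure QuasiDeformation (R : Type u) [CommRing R] where
  /-- the flat extension -/
  R' : Type u
  /-- the deformation -/
  Q : Type u
  [commRingR' : CommRing R']
  [commRingQ : CommRing Q]
  [isLocalRingR' : IsLocalRing R']
  [isLocalRingQ : IsLocalRing Q]
  [isNoetherianRingR' : IsNoetherianRing R']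
  [isNoetherianRingQ : IsNoetherianRing Q]
  /-- the homomorphism `R → R'` -/
  σ : R →+* R'
  /-- the homomorphism `Q → R'` -/
  π : Q →+* R'
  isLocalHom_σ : IsLocalHom σ
  flat_σ : σ.Flat
  surjective_π : Function.Surjective π
  exists_regular : ∃ rs : List Q, RingTheory.Sequence.IsRegular Q rs ∧
    RingHom.ker π = Ideal.ofList rs

attribute [instance] QuasiDeformation.commRingR' QuasiDeformation.commRingQ
  QuasiDeformation.isLocalRingR' QuasiDeformation.isLocalRingQ
  QuasiDeformation.isNoetherianRingR' QuasiDeformation.isNoetherianRingQ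

/-- `pd_Q (M ⊗_R R')`. -/
noncomputable def QuasiDeformation.pd (D : QuasiDeformation R) (M : ModuleCat.{u} R) :
    WithBot ℕ∞ :=
  projectiveDimension ((ModuleCat.restrictScalars D.π).obj ((ModuleCat.extendScalars D.σ).obj M))

/-- `pd_Q R'`, a natural number: the length of the regular sequence. -/
noncomputable def QuasiDeformation.pdBase (D : QuasiDeformation R) : WithBot ℕ∞ :=
  projectiveDimension ((ModuleCat.restrictScalars D.π).obj (ModuleCat.of D.R' D.R'))

/-- The complete intersection dimension over a local ring: the infimum of
`pd_Q (M ⊗_R R') - pd_Q R'` over all quasi-deformations `R → R' ← Q`. The difference is written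
additively; it is never negative for `M ≠ 0`, and the value for `M = 0` is `0`. -/
noncomputable def localCIDim (M : ModuleCat.{u} R) : ℕ∞ :=
  sInf {d : ℕ∞ | ∃ D : QuasiDeformation R, D.pd M ≤ (d : WithBot ℕ∞) + D.pdBase}

/-- The complete intersection dimension over a Noetherian ring: the supremum of the complete
intersection dimensions of the localizations at the maximal ideals. -/
noncomputable def ciDim (M : ModuleCat.{u} R) : ℕ∞ :=
  ⨆ m : MaximalSpectrum R, localCIDim
    (ModuleCat.of (Localization.AtPrime m.asIdeal)
      (LocalizedModule m.asIdeal.primeCompl M))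

end ModuleLinkage

namespace ModuleLinkage

variable {R : Type u} [CommRing R]

/-! ### Long exact sequences of Ext in the first variable -/

section LongExactSequences

variable {S : ShortComplex (ModuleCat.{u} R)} (hS : S.ShortExact) (K : ModuleCat.{u} R)

/-! Everything reduces to two consecutive links. Let M and M' both be linked to N, through φ : X →
M, ψ : Y → N and φ' : X' → M', ψ' : Y' → N. Since Ext^i(Y × Y', K) = 0 for i < n, some K-regular
sequence `rs` of length n kills both Y and Y', and on modules killed by `rs` the functor Ext^n(-, K)
is naturally Hom(-, B) with B = K/(rs)K (`exists_extDuality`). Write * for Hom(-, B). The link then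
says that X ≅ Y* and that ker φ consists of the functionals on Y vanishing on ker ψ, so ker φ ≅ N*.
Hence ker φ and ker φ' are isomorphic.

For i > n + 1 dimension shifting gives Ext^i(M, K) ≅ Ext^{i-1}(ker φ, K). For i = n + 1 this Ext is
the cokernel of X* → (ker φ)*. Because Y → Y** is surjective (`surjective_eval_of_equiv_dual`), it
is the cokernel of N → N**, which again involves only N. Both facts are collected in
`nonempty_equivs_of_linked`.

For the dimensions, let M have finite dimension m; then m ≥ n, as the grade of M is n. The common
kernel has dimension at most m, so M' has dimension at most m + 1. A finite dimension is detected by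
the vanishing of Ext(-, K) (`ResDimLE.of_subsingleton_ext`,
`HasProjectiveDimensionLT.of_subsingleton_ext`), and Ext^i(M', K) ≅ Ext^i(M, K) = 0 for i > m, so
the bound improves to m. Symmetry gives equality.

For the complete intersection dimension the same argument runs over Q for a fixed quasi-deformation
with Q → R' of codimension c. The bridge is that Ext_Q^{c+i}(R' ⊗ M, Q) vanishes exactly when R' ⊗
Ext_R^i(M, R) does (`subsingleton_ext_deform_iff`). -/

include hS in
lemma subsingleton_ext_X₁ {i : ℕ} (h₂ : Subsingleton (Ext S.X₂ K i))
    (h₃ : Subsingleton (Ext S.X₃ K (i + 1))) : Subsingleton (Ext S.X₁ K i) := by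
  refine subsingleton_of_forall_eq 0 fun x => ?_
  obtain ⟨y, rfl⟩ := Ext.contravariant_sequence_exact₁ hS K x (add_comm 1 i)
    (Subsingleton.elim _ _)
  rw [Subsingleton.elim y 0, Ext.comp_zero]

include hS in
lemma subsingleton_ext_X₂ {i : ℕ} (h₁ : Subsingleton (Ext S.X₁ K i))
    (h₃ : Subsingleton (Ext S.X₃ K i)) : Subsingleton (Ext S.X₂ K i) := by
  refine subsingleton_of_forall_eq 0 fun x => ?_
  obtain ⟨y, rfl⟩ := Ext.contravariant_sequence_exact₂ hS K x (Subsingleton.elim _ _)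
  rw [Subsingleton.elim y 0, Ext.comp_zero]

include hS in
lemma subsingleton_ext_X₃ {i : ℕ} (h₁ : Subsingleton (Ext S.X₁ K i))
    (h₂ : Subsingleton (Ext S.X₂ K (i + 1))) : Subsingleton (Ext S.X₃ K (i + 1)) := by
  refine subsingleton_of_forall_eq 0 fun x => ?_
  obtain ⟨y, rfl⟩ := Ext.contravariant_sequence_exact₃ hS K x (Subsingleton.elim _ _)
    (add_comm 1 i)
  rw [Subsingleton.elim y 0, Ext.comp_zero]

/-- The cokernel of `Ext^i(X₂, K) → Ext^i(X₁, K)` is `Ext^{i+1}(X₃, K)` if `Ext^{i+1}(X₂, K)`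
vanishes. -/
noncomputable def extCokerEquiv {i : ℕ} (h₂ : Subsingleton (Ext S.X₂ K (i + 1))) :
    (Ext S.X₁ K i ⧸ LinearMap.range (extMap K i S.f)) ≃ₗ[R] Ext S.X₃ K (i + 1) :=
  (Submodule.quotEquivOfEq _ _ (by
    ext x
    simp only [LinearMap.mem_range, LinearMap.mem_ker]
    constructor
    · rintro ⟨y, rfl⟩
      exact hS.extClass_comp_assoc y (h := add_comm 1 i)
    · exact fun hx => Ext.contravariant_sequence_exact₁ hS K x (add_comm 1 i) hx)).trans
  ((hS.extClass.precompOfLinear R K (add_comm 1 i)).quotKerEquivOfSurjective fun x =>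
    Ext.contravariant_sequence_exact₃ hS K x (Subsingleton.elim _ _) (add_comm 1 i))

/-- Dimension shifting. -/
noncomputable def extShiftEquiv {i : ℕ} (h : Subsingleton (Ext S.X₂ K i))
    (h' : Subsingleton (Ext S.X₂ K (i + 1))) : Ext S.X₁ K i ≃ₗ[R] Ext S.X₃ K (i + 1) :=
  ((Submodule.quotEquivOfEqBot _ (by
    rw [LinearMap.range_eq_bot]
    exact LinearMap.ext fun x => by rw [Subsingleton.elim x 0, map_zero, map_zero])).symm).trans
  (extCokerEquiv hS K h')

end LongExactSequences

lemma shortExact_of_linearMap {A B C : ModuleCat.{u} R} (f : A →ₗ[R] B) (g : B →ₗ[R] C)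
    (hf : Function.Injective f) (hfg : Function.Exact f g) (hg : Function.Surjective g) :
    (ModuleCat.shortComplexOfCompEqZero f g hfg.linearMap_comp_eq_zero).ShortExact where
  exact := ModuleCat.shortComplex_exact _ hfg
  mono_f := (ModuleCat.mono_iff_injective _).mpr hf
  epi_g := (ModuleCat.epi_iff_surjective _).mpr hg

/-- `Ext` is invariant under isomorphisms in the first variable. -/
noncomputable def extCongr {A B : ModuleCat.{u} R} (e : A ≅ B) (K : ModuleCat.{u} R) (i : ℕ) :
    Ext B K i ≃ₗ[R] Ext A K i :=
  LinearEquiv.ofLinearMap (extMap K i e.hom) (extMap K i e.inv)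
    (by ext x; simp [extMap]) (by ext x; simp [extMap])

/-- `Ext^0` is `Hom`. -/
noncomputable def extZeroEquiv (A B : ModuleCat.{u} R) : Ext A B 0 ≃ₗ[R] (A →ₗ[R] B) :=
  Ext.linearEquiv₀.trans ModuleCat.homLinearEquiv

lemma extZeroEquiv_extMap {A B K : ModuleCat.{u} R} (f : A ⟶ B) (x : Ext B K 0) :
    extZeroEquiv A K (extMap K 0 f x) = (extZeroEquiv B K x).comp f.hom := by
  obtain ⟨g, rfl⟩ := (Ext.linearEquiv₀ (R := R)).symm.surjective x
  simp only [extZeroEquiv, extMap, Ext.linearEquiv₀_symm_apply,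
    Ext.bilinearCompOfLinear_apply_apply, LinearEquiv.trans_apply]
  rw [Ext.mk₀_comp_mk₀]
  erw [(Ext.linearEquiv₀ (R := R)).apply_symm_apply, (Ext.linearEquiv₀ (R := R)).apply_symm_apply]
  rfl

lemma smul_ext_eq_zero {Z B : ModuleCat.{u} R} {r : R} (hr : r ∈ Module.annihilator R Z)
    {i : ℕ} (x : Ext Z B i) : r • x = 0 := by
  have h : r • 𝟙 Z = 0 := by
    ext z
    exact Module.mem_annihilator.mp hr z
  have : r • x = (Ext.mk₀ (r • 𝟙 Z)).comp x (zero_add i) := by simp [Ext.mk₀_smul]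
  rw [this, h, Ext.mk₀_zero, Ext.zero_comp]

lemma comp_smul_id {Z B : ModuleCat.{u} R} (r : R) {i : ℕ} (x : Ext Z B i) :
    x.comp (Ext.mk₀ (r • 𝟙 B)) (add_zero i) = r • x := by
  simp [Ext.mk₀_smul]

instance subsingleton_ext_of_projective (P K : ModuleCat.{u} R) [Module.Projective R P] (i : ℕ) :
    Subsingleton (Ext P K (i + 1)) :=
  have := (IsProjective.iff_projective (R := R) P).mp inferInstance
  Ext.subsingleton_of_projective P K i

lemma subsingleton_ext_of_subsingleton (P K : ModuleCat.{u} R) [Subsingleton P] (i : ℕ) :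
    Subsingleton (Ext P K i) :=
  have : Limits.IsZero P := (ModuleCat.isZero_iff_subsingleton).mpr inferInstance
  have := this.hasProjectiveDimensionLT_zero
  HasProjectiveDimensionLT.subsingleton P 0 i (Nat.zero_le i) K

/-! ### Regular sequences and Ext: Rees's argument -/

section Regular

open RingTheory.Sequence
open scoped Pointwise

/-- The class of the extension `0 → B → B → B ⧸ r B → 0`. -/
noncomputable def smulClass {B : ModuleCat.{u} R} {r : R} (hB : IsSMulRegular B r) :
    Ext (ModuleCat.of R (QuotSMulTop r B)) B 1 :=
  hB.smulShortComplex_shortExact.extClass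

section

variable {Z B : ModuleCat.{u} R} {r : R} (hB : IsSMulRegular B r)

/-- Exactness of the sequence induced by multiplication by r on B. With the next lemma: if r kills Z
and Ext^i(Z, B) = 0, the connecting map Ext^i(Z, B/rB) → Ext^{i+1}(Z, B) is bijective. -/
lemma exists_comp_smulClass {i : ℕ} (x : Ext Z B (i + 1)) (hx : r • x = 0) :
    ∃ y : Ext Z (ModuleCat.of R (QuotSMulTop r B)) i, y.comp (smulClass hB) rfl = x :=
  Ext.covariant_sequence_exact₁ Z hB.smulShortComplex_shortExact x
    ((comp_smul_id r x).trans hx) rfl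

lemma eq_zero_of_comp_smulClass_eq_zero {i : ℕ} (h : Subsingleton (Ext Z B i))
    (y : Ext Z (ModuleCat.of R (QuotSMulTop r B)) i) (hy : y.comp (smulClass hB) rfl = 0) :
    y = 0 := by
  obtain ⟨z, rfl⟩ := Ext.covariant_sequence_exact₃ Z hB.smulShortComplex_shortExact y rfl hy
  have hz : z = 0 := @Subsingleton.elim _ h z 0
  rw [hz, Ext.zero_comp]
  rfl

include hB in
lemma subsingleton_ext_quotSMulTop {i : ℕ} (h : Subsingleton (Ext Z B i))
    (h' : Subsingleton (Ext Z B (i + 1))) :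
    Subsingleton (Ext Z (ModuleCat.of R (QuotSMulTop r B)) i) :=
  subsingleton_of_forall_eq 0 fun y =>
    eq_zero_of_comp_smulClass_eq_zero hB h y (Subsingleton.elim _ _)

include hB in
/-- The step of Rees's argument. -/
lemma subsingleton_ext_of_isSMulRegular (hr : r ∈ Module.annihilator R Z) {n : ℕ}
    (h : ∀ i < n, Subsingleton (Ext Z (ModuleCat.of R (QuotSMulTop r B)) i)) :
    ∀ i < n + 1, Subsingleton (Ext Z B i) := by
  rintro (_ | i) hi
  · have := IsSMulRegular.linearMap_subsingleton_of_mem_annihilator hB hr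
    exact (extZeroEquiv Z B).toEquiv.subsingleton
  · refine subsingleton_of_forall_eq 0 fun x => ?_
    have := h i (by omega)
    obtain ⟨y, rfl⟩ := exists_comp_smulClass hB x (smul_ext_eq_zero hr x)
    rw [Subsingleton.elim y 0, Ext.zero_comp]

end

/-- For a sequence `rs` that is regular on `B`, the functor `Ext^n(-, B)`, `n` the length of `rs`,
is represented on the modules killed by `rs` by `B ⧸ rs B`; the representing class is `θ`. -/
lemma exists_ext_representing (rs : List R) (B : ModuleCat.{u} R) (h : IsWeaklyRegular B rs) :
    ∃ (B' : ModuleCat.{u} R) (θ : Ext B' B rs.length),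
      Nonempty (B' ≃ₗ[R] B ⧸ (Ideal.ofList rs • ⊤ : Submodule R B)) ∧
      ∀ Z : ModuleCat.{u} R, (∀ r ∈ rs, r ∈ Module.annihilator R Z) →
        (∀ i < rs.length, Subsingleton (Ext Z B i)) ∧
        Function.Bijective (θ.postcompOfLinear R Z (zero_add rs.length)) := by
  induction rs generalizing B with
  | nil =>
    refine ⟨B, Ext.mk₀ (𝟙 B), ⟨(Submodule.quotEquivOfEqBot _ (by simp)).symm⟩, fun Z _ =>
      ⟨fun i hi => absurd hi (Nat.not_lt_zero i), ?_⟩⟩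
    convert! Function.bijective_id
    ext x
    simp
  | cons r rs ih =>
    rw [isWeaklyRegular_cons_iff] at h
    obtain ⟨B', θ, ⟨e⟩, hθ⟩ := ih (ModuleCat.of R (QuotSMulTop r B)) h.2
    refine ⟨B', θ.comp (smulClass h.1) rfl,
      ⟨e.trans (Submodule.quotOfListConsSMulTopEquivQuotSMulTopInner B r rs).symm⟩,
      fun Z hZ => ?_⟩
    have hr := hZ r List.mem_cons_self
    obtain ⟨h0, hbij⟩ := hθ Z fun s hs => hZ s (List.mem_cons_of_mem _ hs)
    have h1 := subsingleton_ext_of_isSMulRegular h.1 hr h0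
    refine ⟨h1, ?_⟩
    -- Postcomposition with the new class factors as the representing isomorphism for B/rB followed
    -- by the connecting map, which is bijective on modules killed by r.
    have hcomp : ((θ.comp (smulClass h.1) rfl).postcompOfLinear R Z (zero_add (r :: rs).length) :
        Ext Z B' 0 → _) = ((smulClass h.1).postcompOfLinear R Z rfl) ∘
        (θ.postcompOfLinear R Z (zero_add rs.length)) := by
      ext x
      exact (Ext.comp_assoc x θ (smulClass h.1) (zero_add _) rfl (by simp)).symm
    refine (iff_of_eq (congrArg Function.Bijective hcomp)).mpr (Function.Bijective.comp ⟨?_, fun x => ?_⟩ hbij)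
    · rw [injective_iff_map_eq_zero]
      exact fun x hx =>
        eq_zero_of_comp_smulClass_eq_zero h.1 (h1 rs.length (Nat.lt_succ_self _)) x hx
    · exact exists_comp_smulClass h.1 x (smul_ext_eq_zero hr x)

/-- If `Ext^1(K, B)` vanishes and `r` is regular on `B`, then `Hom(K, B ⧸ r B)` is
`Hom(K, B) ⧸ r Hom(K, B)`. -/
lemma nonempty_quotSMulTop_hom_equiv {K B : ModuleCat.{u} R} {r : R} (hreg : IsSMulRegular B r)
    (hB : Subsingleton (Ext K B 1)) :
    Nonempty ((K →ₗ[R] QuotSMulTop r B) ≃ₗ[R] QuotSMulTop r (K →ₗ[R] B)) := by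
  let p : (K →ₗ[R] B) →ₗ[R] (K →ₗ[R] QuotSMulTop r B) :=
    LinearMap.compRight R (Submodule.mkQ (r • (⊤ : Submodule R B)))
  -- The obstruction to lifting a map K → B/rB to B lies in Ext^1(K, B).
  have hp : Function.Surjective p := by
    intro f
    obtain ⟨y, hy⟩ := Ext.covariant_sequence_exact₃ K hreg.smulShortComplex_shortExact
      (Ext.mk₀ (ModuleCat.ofHom f)) rfl (@Subsingleton.elim _ hB _ _)
    obtain ⟨g, rfl⟩ := (Ext.mk₀_bijective _ _).2 y
    rw [Ext.mk₀_comp_mk₀] at hy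
    exact ⟨g.hom, congrArg ModuleCat.Hom.hom ((Ext.mk₀_bijective _ _).1 hy)⟩
  have hker : LinearMap.ker p = r • (⊤ : Submodule R (K →ₗ[R] B)) := by
    ext f
    rw [LinearMap.mem_ker, Submodule.mem_smul_pointwise_iff_exists]
    constructor
    · intro hf
      have : ∀ k, ∃ b, r • b = f k := fun k => by
        have h1 : f k ∈ r • (⊤ : Submodule R B) :=
          (Submodule.Quotient.mk_eq_zero _).mp (LinearMap.congr_fun hf k)
        obtain ⟨b, -, hb⟩ := (Submodule.mem_smul_pointwise_iff_exists _ _ _).mp h1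
        exact ⟨b, hb⟩
      -- Division by r is unique because r is regular on B, so g is automatically linear.
      choose g hg using this
      refine ⟨{ toFun := g, map_add' := fun a b => hreg ?_, map_smul' := fun s a => hreg ?_ },
        trivial, LinearMap.ext hg⟩
      · simp only [hg, map_add, smul_add]
      · simp only [hg, map_smul, RingHom.id_apply]
        rw [smul_comm, hg]
    · rintro ⟨g, -, rfl⟩
      ext k
      exact (Submodule.Quotient.mk_eq_zero _).mpr
        (Submodule.smul_mem_pointwise_smul _ _ _ trivial)
  exact ⟨(p.quotKerEquivOfSurjective hp).symm.trans (Submodule.quotEquivOfEq _ _ hker)⟩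

variable [IsNoetherianRing R]

/-- Since Hom(X, B) = 0, the annihilator of X contains an element regular on B. Passing to the
quotient of B by it shortens the range of vanishing Ext by one. -/
lemma exists_isWeaklyRegular (X B : ModuleCat.{u} R) [Module.Finite R X] [Module.Finite R B]
    (n : ℕ) (h : ∀ i < n, Subsingleton (Ext X B i)) :
    ∃ rs : List R, rs.length = n ∧ (∀ r ∈ rs, r ∈ Module.annihilator R X) ∧
      IsWeaklyRegular B rs := by
  induction n generalizing B with
  | zero => exact ⟨[], rfl, by simp, by simp⟩
  | succ n ih =>
    have h0 := h 0 (Nat.succ_pos n)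
    have h0' : Subsingleton (X →ₗ[R] B) := (extZeroEquiv X B).symm.toEquiv.subsingleton
    obtain ⟨r, hr, hreg⟩ := IsSMulRegular.subsingleton_linearMap_iff.mp h0'
    obtain ⟨rs, hl, hrs, hw⟩ := ih (ModuleCat.of R (QuotSMulTop r B)) fun i hi =>
      subsingleton_ext_quotSMulTop hreg (h i (by omega)) (h (i + 1) (by omega))
    exact ⟨r :: rs, by simp [hl], by simpa using ⟨hr, hrs⟩, .cons hreg hw⟩

/-- A sequence that is regular on `Hom(K, B)` is regular on `B`, if `K` is faithful and
`Ext^i(K, B)` vanishes for `i > 0`. -/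
lemma isWeaklyRegular_of_hom (K : ModuleCat.{u} R) [Module.Finite R K]
    (hK : Module.annihilator R K = ⊥) (rs : List R) (A B : ModuleCat.{u} R) [Module.Finite R B]
    (e : (K →ₗ[R] B) ≃ₗ[R] A) (hB : ∀ i : ℕ, 0 < i → Subsingleton (Ext K B i))
    (h : IsWeaklyRegular A rs) : IsWeaklyRegular B rs := by
  induction rs generalizing A B with
  | nil => simp
  | cons r rs ih =>
    rw [isWeaklyRegular_cons_iff] at h
    have hreg : IsSMulRegular B r := by
      rw [isSMulRegular_iff_ker_lsmul_eq_bot, ← Submodule.subsingleton_iff_eq_bot]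
      -- A map from K into the r-torsion of B is an r-torsion element of Hom(K, B), where r is
      -- regular.
      have hsub : Subsingleton (K →ₗ[R] LinearMap.ker (LinearMap.lsmul R B r)) := by
        refine subsingleton_of_forall_eq 0 fun f => ?_
        have h0 : r • (Submodule.subtype _).comp f = 0 := by
          ext k
          exact (f k).2
        have h1 : r • e ((Submodule.subtype _).comp f) = r • 0 := by
          rw [← map_smul, smul_zero, h0, map_zero]
        have h2 := h.1 h1
        rw [map_eq_zero_iff e e.injective] at h2
        ext k
        exact LinearMap.congr_fun h2 k
      -- Some element of ann K is regular on the r-torsion of B. As K is faithful this element is 0,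
      -- so the torsion vanishes.
      obtain ⟨s, hs, hs'⟩ := IsSMulRegular.subsingleton_linearMap_iff.mp hsub
      rw [hK, Ideal.mem_bot] at hs
      subst hs
      exact IsSMulRegular.zero_iff_subsingleton.mp hs'
    obtain ⟨e'⟩ := nonempty_quotSMulTop_hom_equiv hreg (hB 1 one_pos)
    exact .cons hreg (ih (ModuleCat.of R (QuotSMulTop r A)) (ModuleCat.of R (QuotSMulTop r B))
      (e'.trans (QuotSMulTop.congr r e))
      (fun i hi => subsingleton_ext_quotSMulTop hreg (hB i hi) (hB (i + 1) i.succ_pos)) h.2)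

end Regular

/-! ### Grade and semidualizing modules -/

lemma subsingleton_ext_of_lt_grade {M : ModuleCat.{u} R} {i : ℕ} (h : (i : ℕ∞) < grade M) :
    Subsingleton (Ext M (ModuleCat.of R R) i) := by
  rw [← not_nontrivial_iff_subsingleton]
  intro hn
  exact absurd h (not_lt.mpr (iInf₂_le i hn))

lemma IsSemidualizing.annihilator_eq_bot {K : ModuleCat.{u} R} (hK : IsSemidualizing K) :
    Module.annihilator R K = ⊥ := by
  rw [eq_bot_iff]
  intro r hr
  refine hK.homothety_bijective.1 ?_
  rw [map_zero]
  ext k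
  exact Module.mem_annihilator.mp hr k

/-- Grade is defined by Ext into R, and R ≅ Hom(K, K) transfers it to K: an R-regular sequence in
ann X is also K-regular by `isWeaklyRegular_of_hom`. -/
lemma IsSemidualizing.subsingleton_ext_of_lt_grade [IsNoetherianRing R] {K : ModuleCat.{u} R}
    (hK : IsSemidualizing K) (X : ModuleCat.{u} R) [Module.Finite R X] {n : ℕ}
    (hX : (n : ℕ∞) ≤ grade X) : ∀ i < n, Subsingleton (Ext X K i) := by
  have := hK.finite
  obtain ⟨rs, hl, hrs, hw⟩ := exists_isWeaklyRegular X (ModuleCat.of R R) n fun i hi =>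
    ModuleLinkage.subsingleton_ext_of_lt_grade (lt_of_lt_of_le (by exact_mod_cast hi) hX)
  have hw' := isWeaklyRegular_of_hom K hK.annihilator_eq_bot rs (ModuleCat.of R R) K
    (LinearEquiv.ofBijective _ hK.homothety_bijective).symm hK.ext_eq_zero hw
  obtain ⟨_, _, -, h⟩ := exists_ext_representing rs K hw'
  subst hl
  exact (h X hrs).1

/-! ### Reflexivity over `Hom(-, B)` -/

section Hom

variable {X Y M N B : Type*} [AddCommGroup X] [AddCommGroup Y] [AddCommGroup M] [AddCommGroup N]
  [AddCommGroup B] [Module R X] [Module R Y] [Module R M] [Module R N] [Module R B]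

/-- If `Y` is the dual of `X` and `X` is the dual of `Y`, by any isomorphisms, then the evaluation
map of the Noetherian module `Y` is surjective. -/
lemma surjective_eval_of_equiv_dual [IsNoetherian R Y] (eY : Y ≃ₗ[R] (X →ₗ[R] B))
    (eX : X ≃ₗ[R] (Y →ₗ[R] B)) :
    Function.Surjective (LinearMap.applyₗ : Y →ₗ[R] (Y →ₗ[R] B) →ₗ[R] B) := by
  -- Restriction X*** → X* along X → X**. Evaluation of X* is a section of it, so injectivity of r
  -- makes that evaluation bijective.
  let r : ((((X →ₗ[R] B) →ₗ[R] B)) →ₗ[R] B) →ₗ[R] (X →ₗ[R] B) :=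
    LinearMap.lcomp R B LinearMap.applyₗ
  have hr : ∀ f, r (LinearMap.applyₗ f) = f := fun f => by ext x; rfl
  let e₁ : X ≃ₗ[R] ((X →ₗ[R] B) →ₗ[R] B) := eX.trans (LinearEquiv.congrLeft B R eY)
  let g : (X →ₗ[R] B) ≃ₗ[R] ((((X →ₗ[R] B) →ₗ[R] B)) →ₗ[R] B) := LinearEquiv.congrLeft B R e₁
  have hnoeth : IsNoetherian R (X →ₗ[R] B) := isNoetherian_of_linearEquiv eY
  -- An abstract isomorphism X* ≅ X*** turns r into a surjective endomorphism of a Noetherian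
  -- module.
  have hinj : Function.Injective (r ∘ₗ g.toLinearMap) := by
    refine IsNoetherian.injective_of_surjective_endomorphism _ fun f => ?_
    exact ⟨g.symm (LinearMap.applyₗ f), by simpa using hr f⟩
  have hrinj : Function.Injective r := by
    intro a b hab
    have : (r ∘ₗ g.toLinearMap) (g.symm a) = (r ∘ₗ g.toLinearMap) (g.symm b) := by simpa using hab
    simpa using hinj this
  intro F
  let F' : ((X →ₗ[R] B) →ₗ[R] B) →ₗ[R] B := F ∘ₗ LinearMap.lcomp R B eY.toLinearMap
  refine ⟨eY.symm (r F'), ?_⟩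
  ext h
  have h1 : LinearMap.applyₗ (r F') = F' := hrinj (hr _)
  have h2 := LinearMap.congr_fun h1 (h ∘ₗ eY.symm.toLinearMap)
  have h3 : (h ∘ₗ eY.symm.toLinearMap) ∘ₗ eY.toLinearMap = h := by ext; simp
  simpa [F', LinearMap.lcomp_apply', h3] using h2

variable {φ : X →ₗ[R] M} {ψ : Y →ₗ[R] N} (hψ : Function.Surjective ψ) (β : X ≃ₗ[R] (Y →ₗ[R] B))
  (hβ : ∀ x, φ x = 0 ↔ ∃ h : N →ₗ[R] B, β x = h ∘ₗ ψ)

/-- The isomorphism `Hom(N, B) ≅ ker φ`. -/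
noncomputable def dualEquivKer : (N →ₗ[R] B) ≃ₗ[R] LinearMap.ker φ :=
  LinearEquiv.ofBijective
    (LinearMap.codRestrict (LinearMap.ker φ) (β.symm.toLinearMap ∘ₗ LinearMap.lcomp R B ψ)
      fun h => (hβ _).mpr ⟨h, by simp [LinearMap.lcomp_apply']⟩) (by
    constructor
    · intro h h' hh
      have h1 : β.symm (h ∘ₗ ψ) = β.symm (h' ∘ₗ ψ) := congrArg Subtype.val hh
      exact (LinearMap.cancel_right hψ).mp (β.symm.injective h1)
    · rintro ⟨x, hx⟩
      obtain ⟨h, hh⟩ := (hβ x).mp hx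
      exact ⟨h, Subtype.ext (β.symm_apply_eq.mpr hh.symm)⟩)

lemma dualEquivKer_apply (h : N →ₗ[R] B) :
    (dualEquivKer hψ β hβ h : X) = β.symm (h ∘ₗ ψ) := rfl

include hψ hβ in
/-- The cokernel of `Hom(X, B) → Hom(ker φ, B)` is the cokernel of the evaluation map of `N`. -/
lemma nonempty_coker_equiv_coker_eval
    (hY : Function.Surjective (LinearMap.applyₗ : Y →ₗ[R] (Y →ₗ[R] B) →ₗ[R] B)) :
    Nonempty (((LinearMap.ker φ →ₗ[R] B) ⧸
        LinearMap.range (LinearMap.lcomp R B (LinearMap.ker φ).subtype)) ≃ₗ[R]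
      (((N →ₗ[R] B) →ₗ[R] B) ⧸
        LinearMap.range (LinearMap.applyₗ : N →ₗ[R] (N →ₗ[R] B) →ₗ[R] B))) := by
  refine ⟨Submodule.Quotient.equiv _ _ (LinearEquiv.congrLeft B R (dualEquivKer hψ β hβ).symm) ?_⟩
  ext F
  simp only [Submodule.mem_map, LinearMap.mem_range]
  constructor
  · rintro ⟨_, ⟨G, rfl⟩, rfl⟩
    -- A functional on X ≅ Y* is evaluation at some y; restricted to ker φ ≅ N* it is evaluation at
    -- ψ y.
    obtain ⟨y, hy⟩ := hY (G ∘ₗ β.symm.toLinearMap)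
    refine ⟨ψ y, ?_⟩
    ext h
    have := LinearMap.congr_fun hy (h ∘ₗ ψ)
    simpa [LinearEquiv.congrLeft, dualEquivKer_apply] using this
  · rintro ⟨z, rfl⟩
    obtain ⟨y, rfl⟩ := hψ z
    refine ⟨_, ⟨LinearMap.applyₗ y ∘ₗ β.toLinearMap, rfl⟩, ?_⟩
    ext h
    simp [LinearEquiv.congrLeft, dualEquivKer_apply]

end Hom

/-! ### Duality on the modules killed by a regular sequence -/

/-- The module `Z` is killed by the elements of `rs`. -/
def KilledBy (rs : List R) (Z : ModuleCat.{u} R) : Prop :=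
  ∀ r ∈ rs, r ∈ Module.annihilator R Z

lemma KilledBy.of_injective {rs : List R} {Z W : ModuleCat.{u} R} (h : KilledBy rs W)
    (f : Z →ₗ[R] W) (hf : Function.Injective f) : KilledBy rs Z :=
  fun r hr => f.annihilator_le_of_injective hf (h r hr)

lemma KilledBy.ext {rs : List R} {Z : ModuleCat.{u} R} (h : KilledBy rs Z) (K : ModuleCat.{u} R)
    (i : ℕ) : KilledBy rs (ModuleCat.of R (Ext Z K i)) :=
  fun r hr => Module.mem_annihilator.mpr fun x => smul_ext_eq_zero (h r hr) x

/-- The data of a natural isomorphism `Ext^n(-, K) ≅ Hom(-, B)` on the modules killed by `rs`. -/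
structure ExtDuality (rs : List R) (K : ModuleCat.{u} R) (n : ℕ) (B : ModuleCat.{u} R) where
  /-- the isomorphism -/
  equiv : ∀ Z : ModuleCat.{u} R, KilledBy rs Z → (Ext Z K n ≃ₗ[R] (Z →ₗ[R] B))
  natural : ∀ {Z W : ModuleCat.{u} R} (hZ : KilledBy rs Z) (hW : KilledBy rs W) (f : Z ⟶ W)
    (x : Ext W K n), equiv Z hZ (extMap K n f x) = (equiv W hW x).comp f.hom

lemma exists_extDuality (rs : List R) (K : ModuleCat.{u} R)
    (h : RingTheory.Sequence.IsWeaklyRegular K rs) :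
    ∃ B : ModuleCat.{u} R, Nonempty (B ≃ₗ[R] K ⧸ (Ideal.ofList rs • ⊤ : Submodule R K)) ∧
      Nonempty (ExtDuality rs K rs.length B) := by
  obtain ⟨B, θ, e, hθ⟩ := exists_ext_representing rs K h
  refine ⟨B, e, ⟨⟨fun Z hZ => (LinearEquiv.ofBijective _ (hθ Z hZ).2).symm.trans
    (extZeroEquiv Z B), fun {Z W} hZ hW f x => ?_⟩⟩⟩
  obtain ⟨y, rfl⟩ := (LinearEquiv.ofBijective _ (hθ W hW).2).surjective x
  have h1 : extMap K rs.length f (LinearEquiv.ofBijective _ (hθ W hW).2 y) =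
      LinearEquiv.ofBijective _ (hθ Z hZ).2 (extMap B 0 f y) := by
    exact (Ext.comp_assoc _ y θ (zero_add 0) (zero_add _) (by simp)).symm
  rw [h1, LinearEquiv.trans_apply, LinearEquiv.trans_apply, LinearEquiv.symm_apply_apply,
    LinearEquiv.symm_apply_apply, extZeroEquiv_extMap]

lemma shortExact_kerIncl {X M : ModuleCat.{u} R} (φ : X ⟶ M) (hφ : Function.Surjective φ.hom) :
    (ModuleCat.shortComplexOfCompEqZero (LinearMap.ker φ.hom).subtype φ.hom
      (by ext x; exact x.2)).ShortExact :=
  shortExact_of_linearMap (A := ModuleCat.of R (LinearMap.ker φ.hom)) _ _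
    (Submodule.subtype_injective _) (LinearMap.exact_subtype_ker_map _) hφ

section Link

variable {rs : List R} {K B : ModuleCat.{u} R} {n : ℕ} (D : ExtDuality rs K n B)
  {X Y M N : ModuleCat.{u} R} {φ : X ⟶ M} {ψ : Y ⟶ N}

include D in
-- Through D, the map `linkHom K n ψ` becomes restriction of functionals from Y to ker ψ, whose
-- kernel consists of those factoring through ψ.
lemma exists_dual_equiv_of_homEquiv (hψ : Function.Surjective ψ.hom) (hY : KilledBy rs Y)
    (h : HomEquiv φ (linkHom K n ψ)) :
    ∃ β : X ≃ₗ[R] (Y →ₗ[R] B), ∀ x, φ.hom x = 0 ↔ ∃ f : N →ₗ[R] B, β x = f ∘ₗ ψ.hom := by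
  obtain ⟨α, β, hαβ⟩ := h
  have hker : KilledBy rs (ModuleCat.of R (LinearMap.ker ψ.hom)) :=
    hY.of_injective (LinearMap.ker ψ.hom).subtype (Submodule.subtype_injective _)
  refine ⟨β.toLinearEquiv.trans (D.equiv Y hY), fun x => ?_⟩
  have h1 : α.hom.hom (φ.hom x) = (linkHom K n ψ).hom (β.hom.hom x) :=
    LinearMap.congr_fun (congrArg ModuleCat.Hom.hom hαβ) x
  have h2 : φ.hom x = 0 ↔ extMap K n (kerIncl ψ) (β.hom.hom x) = 0 := by
    rw [← (α.toLinearEquiv).map_eq_zero_iff]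
    change α.hom.hom (φ.hom x) = 0 ↔ _
    rw [h1]
    exact Subtype.ext_iff
  rw [h2, ← (D.equiv _ hker).map_eq_zero_iff, D.natural hker hY]
  constructor
  · intro h3
    have h4 : LinearMap.ker ψ.hom ≤ LinearMap.ker (D.equiv Y hY (β.hom.hom x)) := fun y hy =>
      LinearMap.congr_fun h3 ⟨y, hy⟩
    refine ⟨(Submodule.liftQ _ _ h4) ∘ₗ (ψ.hom.quotKerEquivOfSurjective hψ).symm.toLinearMap, ?_⟩
    ext y
    have : (ψ.hom.quotKerEquivOfSurjective hψ).symm (ψ.hom y) = Submodule.Quotient.mk y := by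
      rw [LinearEquiv.symm_apply_eq]; rfl
    simp only [LinearMap.comp_apply, LinearEquiv.coe_coe, this]
    rfl
  · rintro ⟨f, hf⟩
    have hf' : D.equiv Y hY (β.hom.hom x) = f ∘ₗ ψ.hom := hf
    rw [hf']
    ext y
    have hy : ψ.hom y.1 = 0 := y.2
    exact (congrArg f hy).trans (map_zero f)

include D in
/-- The kernel of `φ` and `Ext^{n+1}(M, K)` for one half of a link of `M` and `N` depend only
on `N`. -/
lemma nonempty_equivs_of_homEquiv [IsNoetherianRing R] [Module.Finite R Y]
    (hφ : Function.Surjective φ.hom) (hψ : Function.Surjective ψ.hom) (hY : KilledBy rs Y)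
    (h : HomEquiv φ (linkHom K n ψ)) (h' : HomEquiv ψ (linkHom K n φ))
    (hX : Subsingleton (Ext X K (n + 1))) :
    Nonempty ((N →ₗ[R] B) ≃ₗ[R] LinearMap.ker φ.hom) ∧
    Nonempty (Ext M K (n + 1) ≃ₗ[R] (((N →ₗ[R] B) →ₗ[R] B) ⧸
        LinearMap.range (LinearMap.applyₗ : N →ₗ[R] (N →ₗ[R] B) →ₗ[R] B))) := by
  obtain ⟨β, hβ⟩ := exists_dual_equiv_of_homEquiv D hψ hY h
  -- X is isomorphic to Ext^n(Y, K), so it inherits the annihilator of Y.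
  have hX' : KilledBy rs X := by
    obtain ⟨-, β₀, -⟩ := h
    exact (hY.ext K n).of_injective β₀.toLinearEquiv.toLinearMap β₀.toLinearEquiv.injective
  obtain ⟨β', -⟩ := exists_dual_equiv_of_homEquiv D hφ hX' h'
  have hev := surjective_eval_of_equiv_dual β' β
  refine ⟨⟨dualEquivKer hψ β hβ⟩, ?_⟩
  obtain ⟨e⟩ := nonempty_coker_equiv_coker_eval hψ β hβ hev
  have hker : KilledBy rs (ModuleCat.of R (LinearMap.ker φ.hom)) :=
    hX'.of_injective (LinearMap.ker φ.hom).subtype (Submodule.subtype_injective _)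
  refine ⟨(extCokerEquiv (shortExact_kerIncl φ hφ) K hX).symm.trans
    (LinearEquiv.trans (Submodule.Quotient.equiv _ _ (D.equiv _ hker) ?_) e)⟩
  ext F
  simp only [Submodule.mem_map, LinearMap.mem_range]
  constructor
  · rintro ⟨_, ⟨x, rfl⟩, rfl⟩
    exact ⟨D.equiv X hX' x, (D.natural hker hX' (kerIncl φ) x).symm⟩
  · rintro ⟨f, rfl⟩
    refine ⟨_, ⟨(D.equiv X hX').symm f, rfl⟩, ?_⟩
    refine (D.natural hker hX' (kerIncl φ) _).trans ?_
    rw [LinearEquiv.apply_symm_apply]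
    rfl

end Link

/-- If `M` and `M'` are linked to the same module `N` by `φ` and `φ'`, then the kernels of `φ` and
`φ'` are isomorphic, and so are the modules `Ext^i(M, K)` and `Ext^i(M', K)` for `i > n`. -/
lemma nonempty_equivs_of_linked [IsNoetherianRing R] {K : ModuleCat.{u} R} [Module.Finite R K]
    {n : ℕ} {X Y M N X' Y' M' : ModuleCat.{u} R} {φ : X ⟶ M} {ψ : Y ⟶ N} {φ' : X' ⟶ M'}
    {ψ' : Y' ⟶ N} [Module.Finite R Y] [Module.Finite R Y']
    (hφ : Function.Surjective φ.hom) (hψ : Function.Surjective ψ.hom)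
    (hφ' : Function.Surjective φ'.hom) (hψ' : Function.Surjective ψ'.hom)
    (h₁ : HomEquiv φ (linkHom K n ψ)) (h₂ : HomEquiv ψ (linkHom K n φ))
    (h₁' : HomEquiv φ' (linkHom K n ψ')) (h₂' : HomEquiv ψ' (linkHom K n φ'))
    (hX : ∀ i, n < i → Subsingleton (Ext X K i)) (hX' : ∀ i, n < i → Subsingleton (Ext X' K i))
    (hY : ∀ i < n, Subsingleton (Ext Y K i)) (hY' : ∀ i < n, Subsingleton (Ext Y' K i)) :
    Nonempty (LinearMap.ker φ.hom ≃ₗ[R] LinearMap.ker φ'.hom) ∧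
    ∀ i, n < i → Nonempty (Ext M K i ≃ₗ[R] Ext M' K i) := by
  have hS := shortExact_of_linearMap (A := Y) (B := ModuleCat.of R (Y × Y')) (C := Y')
    (LinearMap.inl R Y Y') (LinearMap.snd R Y Y') LinearMap.inl_injective
    Function.Exact.inl_snd LinearMap.snd_surjective
  -- A single sequence is chosen for Y and Y' together, so that both links are dualized into the
  -- same B.
  obtain ⟨rs, rfl, hrs, hw⟩ := exists_isWeaklyRegular (ModuleCat.of R (Y × Y')) K n
    fun i hi => subsingleton_ext_X₂ hS K (hY i hi) (hY' i hi)
  have hkY : KilledBy rs Y :=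
    KilledBy.of_injective hrs (LinearMap.inl R Y Y') LinearMap.inl_injective
  have hkY' : KilledBy rs Y' :=
    KilledBy.of_injective hrs (LinearMap.inr R Y Y') LinearMap.inr_injective
  obtain ⟨B, -, ⟨D⟩⟩ := exists_extDuality rs K hw
  obtain ⟨⟨e₁⟩, ⟨e₂⟩⟩ := nonempty_equivs_of_homEquiv D hφ hψ hkY h₁ h₂
    (hX _ (Nat.lt_succ_self _))
  obtain ⟨⟨e₁'⟩, ⟨e₂'⟩⟩ := nonempty_equivs_of_homEquiv D hφ' hψ' hkY' h₁' h₂'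
    (hX' _ (Nat.lt_succ_self _))
  have e := e₁.symm.trans e₁'
  refine ⟨⟨e⟩, fun i hi => ?_⟩
  obtain ⟨j, rfl⟩ : ∃ j, i = j + 1 := ⟨i - 1, by omega⟩
  -- In degree n + 1 both sides are the cokernel of N → N**; above it, both shift to the isomorphic
  -- kernels.
  rcases (Nat.lt_succ_iff.mp hi).eq_or_lt with rfl | hj
  · exact ⟨e₂.trans e₂'.symm⟩
  · exact ⟨((extShiftEquiv (shortExact_kerIncl φ hφ) K (hX j hj) (hX _ hi)).symm.trans
      (extCongr e.symm.toModuleIso K j)).trans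
      (extShiftEquiv (shortExact_kerIncl φ' hφ') K (hX' j hj) (hX' _ hi))⟩

/-! ### Dimension with respect to a resolving class -/

/-- Short exact sequences of linear maps. -/
structure IsSES {A B C : Type*} [AddCommGroup A] [AddCommGroup B] [AddCommGroup C] [Module R A]
    [Module R B] [Module R C] (f : A →ₗ[R] B) (g : B →ₗ[R] C) : Prop where
  injective : Function.Injective f
  exact : Function.Exact f g
  surjective : Function.Surjective g

lemma isSES_ker {B C : Type*} [AddCommGroup B] [AddCommGroup C] [Module R B] [Module R C]
    {g : B →ₗ[R] C} (hg : Function.Surjective g) : IsSES (LinearMap.ker g).subtype g :=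
  ⟨Submodule.subtype_injective _, LinearMap.exact_subtype_ker_map _, hg⟩

lemma isSES_prod (A C : Type*) [AddCommGroup A] [AddCommGroup C] [Module R A] [Module R C] :
    IsSES (LinearMap.inl R A C) (LinearMap.snd R A C) :=
  ⟨LinearMap.inl_injective, Function.Exact.inl_snd, LinearMap.snd_surjective⟩

lemma IsSES.shortExact {A B C : ModuleCat.{u} R} {f : A →ₗ[R] B} {g : B →ₗ[R] C}
    (h : IsSES f g) :
    (ModuleCat.shortComplexOfCompEqZero f g h.exact.linearMap_comp_eq_zero).ShortExact :=
  shortExact_of_linearMap f g h.injective h.exact h.surjective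

/-- The first term of a short exact sequence is the kernel. -/
noncomputable def IsSES.kerEquiv {A B C : Type*} [AddCommGroup A] [AddCommGroup B]
    [AddCommGroup C] [Module R A] [Module R B] [Module R C] {f : A →ₗ[R] B} {g : B →ₗ[R] C}
    (h : IsSES f g) : A ≃ₗ[R] LinearMap.ker g :=
  (LinearEquiv.ofInjective f h.injective).trans
    (LinearEquiv.ofEq _ _ (LinearMap.exact_iff.mp h.exact).symm)

/-- Resolving classes of finitely generated modules. -/
structure IsResolving (G : ModuleCat.{u} R → Prop) : Prop where
  finite : ∀ {A}, G A → Module.Finite R A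
  of_equiv : ∀ {A B : ModuleCat.{u} R}, (A ≃ₗ[R] B) → G A → G B
  of_free : ∀ (A : ModuleCat.{u} R) [Module.Free R A] [Module.Finite R A], G A
  ext : ∀ {A B C : ModuleCat.{u} R} {f : A →ₗ[R] B} {g : B →ₗ[R] C}, IsSES f g → G A → G C → G B
  ker : ∀ {A B C : ModuleCat.{u} R} {f : A →ₗ[R] B} {g : B →ₗ[R] C}, IsSES f g → G B → G C → G A

/-- There is a resolution of length at most `m` by modules in the class `G`. -/
def ResDimLE (G : ModuleCat.{u} R → Prop) : ℕ → ModuleCat.{u} R → Prop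
  | 0, M => G M
  | m + 1, M => ∃ (L P : ModuleCat.{u} R) (f : L →ₗ[R] P) (g : P →ₗ[R] M),
      G P ∧ ResDimLE G m L ∧ IsSES f g

section Resolving

variable {G : ModuleCat.{u} R → Prop} (hG : IsResolving G)
include hG

lemma ResDimLE.of_equiv {m : ℕ} {A B : ModuleCat.{u} R} (e : A ≃ₗ[R] B) (h : ResDimLE G m A) :
    ResDimLE G m B := by
  cases m with
  | zero => exact hG.of_equiv e h
  | succ m =>
    obtain ⟨L, P, f, g, hP, hL, hs⟩ := h
    refine ⟨L, P, f, e.toLinearMap ∘ₗ g, hP, hL, hs.injective, fun x => ?_,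
      e.surjective.comp hs.surjective⟩
    simpa using hs.exact x

lemma ResDimLE.succ {m : ℕ} {A : ModuleCat.{u} R} (h : ResDimLE G m A) :
    ResDimLE G (m + 1) A := by
  induction m generalizing A with
  | zero =>
    refine ⟨ModuleCat.of R PUnit, A, 0, LinearMap.id, h, hG.of_free _,
      Function.injective_of_subsingleton _, fun x => ?_, Function.surjective_id⟩
    simp [eq_comm]
  | succ m ih =>
    obtain ⟨L, P, f, g, hP, hL, hs⟩ := h
    exact ⟨L, P, f, g, hP, ih hL, hs⟩

lemma ResDimLE.mono {m k : ℕ} (hk : m ≤ k) {A : ModuleCat.{u} R} (h : ResDimLE G m A) :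
    ResDimLE G k A := by
  induction hk with
  | refl => exact h
  | step _ ih => exact ih.succ hG

lemma ResDimLE.finite {m : ℕ} {A : ModuleCat.{u} R} (h : ResDimLE G m A) :
    Module.Finite R A := by
  cases m with
  | zero => exact hG.finite h
  | succ m =>
    obtain ⟨L, P, f, g, hP, hL, hs⟩ := h
    have := hG.finite hP
    exact Module.Finite.of_surjective g hs.surjective

lemma ResDimLE.prod {m : ℕ} {A P : ModuleCat.{u} R} (h : ResDimLE G m A) (hP : G P) :
    ResDimLE G m (ModuleCat.of R (A × P)) := by
  cases m with
  | zero => exact hG.ext (C := P) (isSES_prod A P) h hP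
  | succ m =>
    obtain ⟨L, Q, f, g, hQ, hL, hs⟩ := h
    refine ⟨L, ModuleCat.of R (Q × P), LinearMap.inl R Q P ∘ₗ f, g.prodMap LinearMap.id,
      hG.ext (C := P) (isSES_prod Q P) hQ hP, hL,
      LinearMap.inl_injective.comp hs.injective, ?_,
      Function.Surjective.prodMap hs.surjective Function.surjective_id⟩
    rintro ⟨q, p⟩
    have := hs.exact q
    simp only [LinearMap.prodMap_apply, LinearMap.id_apply, Prod.mk_eq_zero, Set.mem_range,
      LinearMap.comp_apply, LinearMap.inl_apply, Prod.mk.injEq] at this ⊢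
    rw [this]
    exact ⟨fun ⟨⟨y, hy⟩, hp⟩ => ⟨y, hy, hp.symm⟩, fun ⟨y, hy, hp⟩ => ⟨⟨y, hy⟩, hp.symm⟩⟩

/-- Kernels of epimorphisms onto modules in the class. -/
lemma ResDimLE.ker {m : ℕ} {A Q P : ModuleCat.{u} R} {f : A →ₗ[R] Q} {g : Q →ₗ[R] P}
    (hs : IsSES f g) (hQ : ResDimLE G m Q) (hP : G P) : ResDimLE G m A := by
  cases m with
  | zero => exact hG.ker hs hQ hP
  | succ m =>
    obtain ⟨L, P₀, i, q, hP₀, hL, hs'⟩ := hQ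
    refine ResDimLE.of_equiv hG (A := ModuleCat.of R (LinearMap.ker g)) hs.kerEquiv.symm ?_
    have hgq : Function.Surjective (g ∘ₗ q) := hs.surjective.comp hs'.surjective
    refine ⟨L, ModuleCat.of R (LinearMap.ker (g ∘ₗ q)),
      i.codRestrict _ fun x => by simp [hs'.exact.apply_apply_eq_zero],
      (q ∘ₗ (LinearMap.ker (g ∘ₗ q)).subtype).codRestrict _ fun x => x.2,
      hG.ker (B := P₀) (C := P) (isSES_ker hgq) hP₀ hP, hL, ?_, ?_, ?_⟩
    · exact fun x y hxy => hs'.injective (congrArg Subtype.val hxy)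
    · rintro ⟨x, hx⟩
      have := hs'.exact x
      rw [Subtype.ext_iff]
      refine this.trans ⟨fun ⟨y, hy⟩ => ⟨y, Subtype.ext hy⟩, fun ⟨y, hy⟩ => ⟨y, congrArg Subtype.val hy⟩⟩
    · rintro ⟨x, hx⟩
      obtain ⟨y, rfl⟩ := hs'.surjective x
      exact ⟨⟨y, hx⟩, rfl⟩

omit hG in
/-- The pullback of two epimorphisms. -/
lemma isSES_pullback {A B M : Type*} [AddCommGroup A] [AddCommGroup B] [AddCommGroup M]
    [Module R A] [Module R B] [Module R M] {p : A →ₗ[R] M} {q : B →ₗ[R] M}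
    (hp : Function.Surjective p) :
    IsSES ((LinearMap.inl R A B ∘ₗ (LinearMap.ker p).subtype).codRestrict
        (LinearMap.eqLocus (p ∘ₗ LinearMap.fst R A B) (q ∘ₗ LinearMap.snd R A B))
        fun x => by simp [LinearMap.mem_eqLocus])
      (LinearMap.snd R A B ∘ₗ (LinearMap.eqLocus (p ∘ₗ LinearMap.fst R A B)
        (q ∘ₗ LinearMap.snd R A B)).subtype) := by
  refine ⟨fun x y hxy => ?_, ?_, fun b => ?_⟩
  · exact Subtype.ext (congrArg (fun z => z.1.1) hxy)
  · rintro ⟨⟨a, b⟩, hab⟩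
    have hab' : p a = q b := hab
    constructor
    · intro hb
      have hb' : b = 0 := hb
      subst hb'
      exact ⟨⟨a, by simpa using hab'⟩, rfl⟩
    · rintro ⟨x, hx⟩
      exact (congrArg (fun z => z.1.2) hx).symm
  · obtain ⟨a, ha⟩ := hp (q b)
    exact ⟨⟨(a, b), ha⟩, rfl⟩

omit hG in
lemma isSES_pullback' {A B M : Type*} [AddCommGroup A] [AddCommGroup B] [AddCommGroup M]
    [Module R A] [Module R B] [Module R M] {p : A →ₗ[R] M} {q : B →ₗ[R] M}
    (hq : Function.Surjective q) :
    IsSES ((LinearMap.inr R A B ∘ₗ (LinearMap.ker q).subtype).codRestrict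
        (LinearMap.eqLocus (p ∘ₗ LinearMap.fst R A B) (q ∘ₗ LinearMap.snd R A B))
        fun x => by simp [LinearMap.mem_eqLocus])
      (LinearMap.fst R A B ∘ₗ (LinearMap.eqLocus (p ∘ₗ LinearMap.fst R A B)
        (q ∘ₗ LinearMap.snd R A B)).subtype) := by
  refine ⟨fun x y hxy => ?_, ?_, fun a => ?_⟩
  · exact Subtype.ext (congrArg (fun z => z.1.2) hxy)
  · rintro ⟨⟨a, b⟩, hab⟩
    have hab' : p a = q b := hab
    constructor
    · intro ha
      have ha' : a = 0 := ha
      subst ha'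
      exact ⟨⟨b, by simpa using hab'.symm⟩, rfl⟩
    · rintro ⟨x, hx⟩
      exact (congrArg (fun z => z.1.1) hx).symm
  · obtain ⟨b, hb⟩ := hq (p a)
    exact ⟨⟨(a, b), hb.symm⟩, rfl⟩

omit hG in
/-- Short exact sequences with projective quotient split. -/
lemma IsSES.nonempty_equiv_prod {A B P : Type*} [AddCommGroup A] [AddCommGroup B]
    [AddCommGroup P] [Module R A] [Module R B] [Module R P] [Module.Projective R P]
    {f : A →ₗ[R] B} {g : B →ₗ[R] P} (h : IsSES f g) : Nonempty (B ≃ₗ[R] A × P) := by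
  obtain ⟨s, hs⟩ := Module.projective_lifting_property g LinearMap.id h.surjective
  exact ⟨(h.exact.splitSurjectiveEquiv h.injective ⟨s, hs⟩).1⟩

/-- First syzygies. -/
lemma ResDimLE.syzygy {m : ℕ} {P M : ModuleCat.{u} R} [Module.Free R P] [Module.Finite R P]
    {p : P →ₗ[R] M} (hp : Function.Surjective p) (hM : ResDimLE G (m + 1) M) :
    ResDimLE G m (ModuleCat.of R (LinearMap.ker p)) := by
  obtain ⟨L, Q, i, q, hQ, hL, hs⟩ := hM
  -- The pullback of P and Q over M is L × P, since P is projective, and it also maps onto Q with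
  -- kernel ker p.
  have h1 := isSES_pullback' (p := p) hs.surjective
  obtain ⟨e⟩ := h1.nonempty_equiv_prod
  have h2 := isSES_pullback (q := q) hp
  refine ResDimLE.ker hG (A := ModuleCat.of R (LinearMap.ker p)) (Q := ModuleCat.of R
    (LinearMap.eqLocus (p ∘ₗ LinearMap.fst R P Q) (q ∘ₗ LinearMap.snd R P Q))) (P := Q) h2 ?_ hQ
  exact ResDimLE.of_equiv hG e.symm (ResDimLE.prod hG
    (ResDimLE.of_equiv hG (B := ModuleCat.of R (LinearMap.ker q)) hs.kerEquiv hL) (hG.of_free P))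

lemma ResDimLE.syzygy_same {m : ℕ} {P M : ModuleCat.{u} R} [Module.Free R P] [Module.Finite R P]
    {p : P →ₗ[R] M} (hp : Function.Surjective p) (hM : ResDimLE G m M) :
    ResDimLE G m (ModuleCat.of R (LinearMap.ker p)) :=
  ResDimLE.syzygy hG hp (hM.succ hG)

omit hG in
lemma exists_free_cover (M : ModuleCat.{u} R) [Module.Finite R M] :
    ∃ (P : ModuleCat.{u} R) (p : P →ₗ[R] M), Module.Free R P ∧ Module.Finite R P ∧
      Function.Surjective p := by
  obtain ⟨n, f, hf⟩ := Module.Finite.exists_fin' R M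
  exact ⟨ModuleCat.of R (Fin n → R), f, inferInstance, inferInstance, hf⟩

/-- Horseshoe argument: free covers of A and C combine to one of B, and its kernel is an extension
of ker q by ker p. -/
lemma ResDimLE.ext {m : ℕ} {A B C : ModuleCat.{u} R} {f : A →ₗ[R] B} {g : B →ₗ[R] C}
    (hs : IsSES f g) (hA : ResDimLE G m A) (hC : ResDimLE G m C) : ResDimLE G m B := by
  induction m generalizing A B C with
  | zero => exact hG.ext hs hA hC
  | succ m ih =>
    have := hA.finite hG
    have := hC.finite hG
    obtain ⟨P, p, _, _, hp⟩ := exists_free_cover A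
    obtain ⟨Q, q, _, _, hq⟩ := exists_free_cover C
    obtain ⟨l, hl⟩ := Module.projective_lifting_property g q hs.surjective
    have hl' : ∀ x, g (l x) = q x := LinearMap.congr_fun hl
    have hgf : ∀ x, g (f x) = 0 := hs.exact.apply_apply_eq_zero
    let r : ModuleCat.of R (P × Q) →ₗ[R] B := (f ∘ₗ p).coprod l
    have hr : ∀ x y, r (x, y) = f (p x) + l y := fun x y => rfl
    have hrs : Function.Surjective r := by
      intro b
      obtain ⟨y, hy⟩ := hq (g b)
      obtain ⟨a, ha⟩ := (hs.exact (b - l y)).mp (by rw [map_sub, hl', hy, sub_self])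
      obtain ⟨x, rfl⟩ := hp a
      exact ⟨(x, y), by rw [hr, ha, sub_add_cancel]⟩
    have hker : ∀ z : LinearMap.ker r, q z.1.2 = 0 := by
      rintro ⟨⟨x, y⟩, hxy⟩
      have h1 : f (p x) + l y = 0 := hxy
      have h2 := congrArg g h1
      rwa [map_add, hgf, zero_add, hl', map_zero] at h2
    refine ⟨ModuleCat.of R (LinearMap.ker r), ModuleCat.of R (P × Q), _, r,
      hG.of_free _, ?_, isSES_ker hrs⟩
    refine ih (A := ModuleCat.of R (LinearMap.ker p)) (C := ModuleCat.of R (LinearMap.ker q))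
      (f := (LinearMap.inl R P Q ∘ₗ (LinearMap.ker p).subtype).codRestrict (LinearMap.ker r)
        fun x => by
          have hx : p x.1 = 0 := x.2
          change f (p x.1) + l 0 = 0
          rw [hx, map_zero, map_zero, add_zero])
      (g := (LinearMap.snd R P Q ∘ₗ (LinearMap.ker r).subtype).codRestrict _ hker) ?_
      (hA.syzygy hG hp) (hC.syzygy hG hq)
    refine ⟨fun x y hxy => Subtype.ext (congrArg (fun z => z.1.1) hxy), ?_, ?_⟩
    · rintro ⟨⟨x, y⟩, hxy⟩
      constructor
      · intro hy
        have hy' : y = 0 := congrArg Subtype.val hy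
        subst hy'
        have h1 : f (p x) + l 0 = 0 := hxy
        rw [map_zero, add_zero] at h1
        exact ⟨⟨x, hs.injective (h1.trans (map_zero f).symm)⟩, rfl⟩
      · rintro ⟨z, hz⟩
        exact Subtype.ext (congrArg (fun z => z.1.2) hz).symm
    · rintro ⟨y, hy⟩
      have hy' : q y = 0 := hy
      obtain ⟨a, ha⟩ := (hs.exact (l y)).mp (by rw [hl', hy'])
      obtain ⟨x, rfl⟩ := hp a
      refine ⟨⟨(-x, y), ?_⟩, rfl⟩
      change f (p (-x)) + l y = 0
      rw [map_neg, map_neg, ha, neg_add_cancel]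

/-- For a free cover P → B, the kernel of P → C is an extension of A by a syzygy of B, hence of
dimension at most m. -/
lemma ResDimLE.coker {m : ℕ} {A B C : ModuleCat.{u} R} {f : A →ₗ[R] B} {g : B →ₗ[R] C}
    (hs : IsSES f g) (hA : ResDimLE G m A) (hB : ResDimLE G m B) : ResDimLE G (m + 1) C := by
  have := hB.finite hG
  obtain ⟨P, p, _, _, hp⟩ := exists_free_cover B
  have hgp : Function.Surjective (g ∘ₗ p) := hs.surjective.comp hp
  refine ⟨ModuleCat.of R (LinearMap.ker (g ∘ₗ p)), P, _, g ∘ₗ p, hG.of_free P, ?_, isSES_ker hgp⟩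
  refine ResDimLE.ext hG (A := ModuleCat.of R (LinearMap.ker p))
    (C := ModuleCat.of R (LinearMap.ker g))
    (f := Submodule.inclusion (LinearMap.ker_le_ker_comp p g))
    (g := (p ∘ₗ (LinearMap.ker (g ∘ₗ p)).subtype).codRestrict _ fun x => x.2) ?_
    (hB.syzygy_same hG hp)
    (ResDimLE.of_equiv hG (B := ModuleCat.of R (LinearMap.ker g)) hs.kerEquiv hA)
  refine ⟨Submodule.inclusion_injective _, ?_, ?_⟩
  · rintro ⟨x, hx⟩
    constructor
    · exact fun h => ⟨⟨x, congrArg Subtype.val h⟩, rfl⟩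
    · rintro ⟨y, hy⟩
      have : y.1 = x := congrArg Subtype.val hy
      exact Subtype.ext (this ▸ y.2)
  · rintro ⟨x, hx⟩
    obtain ⟨y, rfl⟩ := hp x
    exact ⟨⟨y, hx⟩, rfl⟩

/-- The pullback of B and a free cover P of C is an extension of B by a syzygy of C, and A is the
kernel of its projection to P. -/
lemma ResDimLE.ker_of_coker {m : ℕ} {A B C : ModuleCat.{u} R} {f : A →ₗ[R] B} {g : B →ₗ[R] C}
    (hs : IsSES f g) (hB : ResDimLE G m B) (hC : ResDimLE G m C) : ResDimLE G m A := by
  have := hC.finite hG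
  obtain ⟨P, p, _, _, hp⟩ := exists_free_cover C
  refine ResDimLE.of_equiv hG (A := ModuleCat.of R (LinearMap.ker g)) hs.kerEquiv.symm ?_
  have h1 := isSES_pullback (q := p) hs.surjective
  have h2 := isSES_pullback' (p := g) hp
  refine ResDimLE.ker hG (A := ModuleCat.of R (LinearMap.ker g)) (Q := ModuleCat.of R
    (LinearMap.eqLocus (g ∘ₗ LinearMap.fst R B P) (p ∘ₗ LinearMap.snd R B P))) (P := P) h1 ?_
    (hG.of_free P)
  exact ResDimLE.ext hG (A := ModuleCat.of R (LinearMap.ker p)) (C := B) h2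
    (hC.syzygy_same hG hp) hB

omit hG in
/-- Vanishing of `Ext` above the dimension. -/
lemma ResDimLE.subsingleton_ext {K : ModuleCat.{u} R}
    (hK : ∀ A, G A → ∀ i : ℕ, 0 < i → Subsingleton (Ext A K i)) {m : ℕ} {M : ModuleCat.{u} R}
    (h : ResDimLE G m M) : ∀ i, m < i → Subsingleton (Ext M K i) := by
  induction m generalizing M with
  | zero => exact hK M h
  | succ m ih =>
    obtain ⟨L, P, f, g, hP, hL, hs⟩ := h
    rintro (_ | i) hi
    · omega
    · exact subsingleton_ext_X₃ hs.shortExact K (ih hL i (by omega)) (hK P hP _ i.succ_pos)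

omit hG in
/-- A module of finite dimension has dimension at most `r` if `Ext^i(-, K)` vanishes for
`i > r`. -/
lemma ResDimLE.of_subsingleton_ext {K : ModuleCat.{u} R}
    (hK : ∀ A, G A → ∀ i : ℕ, 0 < i → Subsingleton (Ext A K i))
    (hbase : ∀ {A B C : ModuleCat.{u} R} {f : A →ₗ[R] B} {g : B →ₗ[R] C}, IsSES f g → G A → G B →
      Subsingleton (Ext C K 1) → G C)
    {m : ℕ} {M : ModuleCat.{u} R} (h : ResDimLE G m M) {r : ℕ} (hr : r ≤ m)
    (hM : ∀ i, r < i → Subsingleton (Ext M K i)) : ResDimLE G r M := by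
  induction m generalizing M r with
  | zero =>
    obtain rfl : r = 0 := by omega
    exact h
  | succ m ih =>
    rcases hr.eq_or_lt with rfl | hr
    · exact h
    obtain ⟨L, P, f, g, hP, hL, hs⟩ := h
    cases r with
    | zero =>
      refine hbase hs ?_ hP (hM 1 one_pos)
      -- The syzygy L inherits the vanishing in all positive degrees, so induction puts L itself in
      -- the class.
      exact ih hL (Nat.zero_le m) fun i hi =>
        subsingleton_ext_X₁ hs.shortExact K (hK P hP i hi) (hM (i + 1) i.succ_pos)
    | succ r =>
      refine ⟨L, P, f, g, hP, ih hL (by omega) fun i hi => ?_, hs⟩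
      exact subsingleton_ext_X₁ hs.shortExact K (hK P hP i (by omega)) (hM (i + 1) (by omega))

end Resolving

/-! ### Totally reflexive modules form a resolving class -/

section

variable {K : ModuleCat.{u} R}

lemma IsTotallyReflexive.of_equiv {A B : ModuleCat.{u} R} (e : A ≃ₗ[R] B)
    (h : IsTotallyReflexive K A) : IsTotallyReflexive K B where
  finite := have := h.finite; Module.Finite.equiv e
  eval_bijective := by
    have h1 : (LinearMap.applyₗ : B →ₗ[R] (B →ₗ[R] K) →ₗ[R] K) =
        (LinearEquiv.congrLeft K R (LinearEquiv.congrLeft K R e)).toLinearMap ∘ₗ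
          LinearMap.applyₗ ∘ₗ e.symm.toLinearMap := by
      ext b f
      simp [LinearEquiv.congrLeft]
    rw [h1]
    exact (LinearEquiv.bijective (LinearEquiv.congrLeft K R (LinearEquiv.congrLeft K R e))).comp (h.eval_bijective.comp e.symm.bijective)
  ext_eq_zero i hi := by
    have := h.ext_eq_zero i hi
    exact (extCongr (A := A) (B := B) e.toModuleIso K i).toEquiv.subsingleton
  ext_dual_eq_zero i hi := by
    have := h.ext_dual_eq_zero i hi
    exact (extCongr (A := kDual K B) (B := kDual K A)
      (LinearEquiv.congrLeft K R e).symm.toModuleIso K i).symm.toEquiv.subsingleton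

lemma exists_extension_of_subsingleton_ext {A B C : ModuleCat.{u} R} {f : A →ₗ[R] B}
    {g : B →ₗ[R] C} (hs : IsSES f g) (h : Subsingleton (Ext C K 1)) (x : A →ₗ[R] K) :
    ∃ y : B →ₗ[R] K, y ∘ₗ f = x := by
  obtain ⟨y, hy⟩ := Ext.contravariant_sequence_exact₁ hs.shortExact K
    (Ext.mk₀ (ModuleCat.ofHom x)) (add_comm 1 0) (@Subsingleton.elim _ h _ _)
  obtain ⟨z, rfl⟩ := (Ext.mk₀_bijective _ _).2 y
  rw [Ext.mk₀_comp_mk₀] at hy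
  exact ⟨z.hom, congrArg ModuleCat.Hom.hom ((Ext.mk₀_bijective _ _).1 hy)⟩

lemma IsSES.dual_exact {A B C : ModuleCat.{u} R} {f : A →ₗ[R] B} {g : B →ₗ[R] C}
    (hs : IsSES f g) : Function.Exact (LinearMap.lcomp R K g) (LinearMap.lcomp R K f) := by
  intro x
  constructor
  · intro hx
    have h4 : LinearMap.ker g ≤ LinearMap.ker x := by
      rw [LinearMap.exact_iff.mp hs.exact]
      rintro _ ⟨a, rfl⟩
      exact LinearMap.congr_fun hx a
    refine ⟨(Submodule.liftQ _ _ h4) ∘ₗ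
      (g.quotKerEquivOfSurjective hs.surjective).symm.toLinearMap, ?_⟩
    ext y
    have : (g.quotKerEquivOfSurjective hs.surjective).symm (g y) = Submodule.Quotient.mk y := by
      rw [LinearEquiv.symm_apply_eq]; rfl
    simp only [LinearMap.lcomp_apply, LinearMap.comp_apply, LinearEquiv.coe_coe, this]
    rfl
  · rintro ⟨y, rfl⟩
    ext a
    change y (g (f a)) = 0
    rw [hs.exact.apply_apply_eq_zero, map_zero]

lemma lcomp_injective_of_surjective {B C : ModuleCat.{u} R} {g : B →ₗ[R] C}
    (hg : Function.Surjective g) : Function.Injective (LinearMap.lcomp R K g) :=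
  fun _ _ h => (LinearMap.cancel_right hg).mp h

/-- Dualizing a short exact sequence. -/
lemma IsSES.dual {A B C : ModuleCat.{u} R} {f : A →ₗ[R] B} {g : B →ₗ[R] C}
    (hs : IsSES f g) (h : Subsingleton (Ext C K 1)) :
    IsSES (A := kDual K C) (B := kDual K B) (C := kDual K A)
      (LinearMap.lcomp R K g) (LinearMap.lcomp R K f) :=
  ⟨lcomp_injective_of_surjective hs.surjective, hs.dual_exact,
    exists_extension_of_subsingleton_ext hs h⟩

lemma eval_naturality {A B : Type*} [AddCommGroup A] [AddCommGroup B] [Module R A] [Module R B]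
    (f : A →ₗ[R] B) (a : A) :
    (LinearMap.applyₗ (f a) : (B →ₗ[R] K) →ₗ[R] K) =
      LinearMap.lcomp R K (LinearMap.lcomp R K f) (LinearMap.applyₗ a) := rfl

section SES

variable {A B C : ModuleCat.{u} R} {f : A →ₗ[R] B} {g : B →ₗ[R] C} (hs : IsSES f g)
include hs

/-- Dualizing twice stays exact, so evaluation compares the given sequence with its double dual, and
the five lemma applies; the chase is done by hand. -/
lemma IsTotallyReflexive.ext (hA : IsTotallyReflexive K A) (hC : IsTotallyReflexive K C) :
    IsTotallyReflexive K B where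
  finite := by
    have := hA.finite
    have := hC.finite
    exact Module.Finite.of_exact hs.exact hs.surjective
  ext_eq_zero i hi :=
    subsingleton_ext_X₂ hs.shortExact K (hA.ext_eq_zero i hi) (hC.ext_eq_zero i hi)
  ext_dual_eq_zero i hi :=
    subsingleton_ext_X₂ (IsSES.shortExact (A := kDual K C) (B := kDual K B) (C := kDual K A)
      (hs.dual (hC.ext_eq_zero 1 one_pos))) K
      (hC.ext_dual_eq_zero i hi) (hA.ext_dual_eq_zero i hi)
  eval_bijective := by
    have hd := hs.dual (hC.ext_eq_zero 1 one_pos)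
    have hdd := IsSES.dual (K := K) (A := kDual K C) (B := kDual K B) (C := kDual K A) hd
      (hA.ext_dual_eq_zero 1 one_pos)
    constructor
    · rw [injective_iff_map_eq_zero]
      intro b hb
      have h1 : g b = 0 := by
        refine (injective_iff_map_eq_zero _).mp hC.eval_bijective.1 _ ?_
        rw [eval_naturality, hb, map_zero]
      obtain ⟨a, rfl⟩ := (hs.exact b).mp h1
      have h2 : (LinearMap.applyₗ a : (A →ₗ[R] K) →ₗ[R] K) = 0 := by
        refine (injective_iff_map_eq_zero _).mp hdd.injective _ ?_
        rw [← hb]; rfl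
      rw [(injective_iff_map_eq_zero _).mp hA.eval_bijective.1 a h2, map_zero]
    · intro F
      obtain ⟨c, hc⟩ := hC.eval_bijective.2 (LinearMap.lcomp R K (LinearMap.lcomp R K g) F)
      obtain ⟨b, rfl⟩ := hs.surjective c
      obtain ⟨H, hH⟩ := (hdd.exact (F - LinearMap.applyₗ b)).mp (by
        rw [map_sub, ← eval_naturality, hc, sub_self])
      obtain ⟨a, rfl⟩ := hA.eval_bijective.2 H
      refine ⟨f a + b, ?_⟩
      rw [map_add, eval_naturality, hH, sub_add_cancel]

/-- Reflexivity is a chase in the double dual, where A** → B** is injective because B* → A* is onto.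
The delicate point is Ext^1(A*, K). -/
lemma IsTotallyReflexive.ker [IsNoetherianRing R] (hB : IsTotallyReflexive K B)
    (hC : IsTotallyReflexive K C) : IsTotallyReflexive K A := by
  have hd := hs.dual (hC.ext_eq_zero 1 one_pos)
  have hdS := IsSES.shortExact (A := kDual K C) (B := kDual K B) (C := kDual K A) hd
  have hB' := hB.finite
  refine ⟨Module.Finite.of_injective f hs.injective, ⟨?_, ?_⟩, fun i hi => ?_, ?_⟩
  · rw [injective_iff_map_eq_zero]
    intro a ha
    refine (injective_iff_map_eq_zero _).mp hs.injective _
      ((injective_iff_map_eq_zero _).mp hB.eval_bijective.1 _ ?_)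
    rw [eval_naturality, ha, map_zero]
  · intro F
    obtain ⟨b, hb⟩ := hB.eval_bijective.2 (LinearMap.lcomp R K (LinearMap.lcomp R K f) F)
    have h1 : g b = 0 := by
      refine (injective_iff_map_eq_zero _).mp hC.eval_bijective.1 _ ?_
      rw [eval_naturality, hb]
      exact (IsSES.dual_exact (K := K) (A := kDual K C) (B := kDual K B) (C := kDual K A) hd).apply_apply_eq_zero F
    obtain ⟨a, rfl⟩ := (hs.exact b).mp h1
    refine ⟨a, ?_⟩
    refine (lcomp_injective_of_surjective (B := kDual K B) (C := kDual K A) (K := K)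
      hd.surjective) ?_
    rw [← hb]; rfl
  · exact subsingleton_ext_X₁ hs.shortExact K (hB.ext_eq_zero i hi) (hC.ext_eq_zero _ i.succ_pos)
  · rintro (_ | _ | i) hi
    · omega
    -- As Ext^1(B*, K) = 0, Ext^1(A*, K) is the cokernel of B** → C**. Every functional on C* is
    -- evaluation at some g b, hence comes from evaluation at b.
    · refine subsingleton_of_forall_eq 0 fun x => ?_
      obtain ⟨y, rfl⟩ := Ext.contravariant_sequence_exact₃ hdS K x
        (@Subsingleton.elim _ (hB.ext_dual_eq_zero 1 one_pos) _ _) (add_comm 1 0)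
      obtain ⟨z, rfl⟩ := (Ext.mk₀_bijective _ _).2 y
      obtain ⟨c, hc⟩ := hC.eval_bijective.2 z.hom
      obtain ⟨b, rfl⟩ := hs.surjective c
      have hz : z = (ModuleCat.shortComplexOfCompEqZero _ _
          hd.exact.linearMap_comp_eq_zero).f ≫ ModuleCat.ofHom (LinearMap.applyₗ b) := by
        ext : 1
        exact hc.symm
      rw [hz, ← Ext.mk₀_comp_mk₀]
      exact hdS.extClass_comp_assoc _ (h := add_comm 1 0)
    · exact subsingleton_ext_X₃ hdS K (hC.ext_dual_eq_zero _ i.succ_pos)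
        (hB.ext_dual_eq_zero _ (Nat.succ_pos _))

/-- Vanishing of Ext^1(C, K) keeps the dual sequence exact, so the evaluation of C is induced on
cokernels by those of A and B. This is the hypothesis `hbase` of `ResDimLE.of_subsingleton_ext`. -/
lemma IsTotallyReflexive.coker (hA : IsTotallyReflexive K A) (hB : IsTotallyReflexive K B)
    (hC : Subsingleton (Ext C K 1)) : IsTotallyReflexive K C := by
  have hd := hs.dual hC
  have hdS := IsSES.shortExact (A := kDual K C) (B := kDual K B) (C := kDual K A) hd
  have hdd := IsSES.dual (K := K) (A := kDual K C) (B := kDual K B) (C := kDual K A) hd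
      (hA.ext_dual_eq_zero 1 one_pos)
  have hB' := hB.finite
  refine ⟨Module.Finite.of_surjective g hs.surjective, ⟨?_, ?_⟩, ?_, fun i hi => ?_⟩
  · rw [injective_iff_map_eq_zero]
    intro c hc
    obtain ⟨b, rfl⟩ := hs.surjective c
    rw [eval_naturality] at hc
    obtain ⟨H, hH⟩ := (hdd.exact _).mp hc
    obtain ⟨a, rfl⟩ := hA.eval_bijective.2 H
    rw [← eval_naturality] at hH
    rw [← hB.eval_bijective.1 hH, hs.exact.apply_apply_eq_zero]
  · intro F
    obtain ⟨H, rfl⟩ := hdd.surjective F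
    obtain ⟨b, rfl⟩ := hB.eval_bijective.2 H
    exact ⟨g b, eval_naturality g b⟩
  · rintro (_ | _ | i) hi
    · omega
    · exact hC
    · exact subsingleton_ext_X₃ hs.shortExact K (hA.ext_eq_zero _ i.succ_pos)
        (hB.ext_eq_zero _ (Nat.succ_pos _))
  · exact subsingleton_ext_X₁ hdS K (hB.ext_dual_eq_zero i hi)
      (hA.ext_dual_eq_zero _ i.succ_pos)

end SES

/-- Under Hom(R, K) ≅ K the evaluation map of R becomes the homothety map, and Ext^i(Hom(R, K), K)
becomes Ext^i(K, K). -/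
lemma isTotallyReflexive_ring (hK : IsSemidualizing K) :
    IsTotallyReflexive K (ModuleCat.of R R) where
  finite := inferInstanceAs (Module.Finite R R)
  eval_bijective := by
    have h1 : (LinearMap.applyₗ : R →ₗ[R] (R →ₗ[R] K) →ₗ[R] K) =
        (LinearEquiv.congrLeft K R (LinearMap.ringLmapEquivSelf R R K).symm).toLinearMap ∘ₗ
          LinearMap.lsmul R K := by
      ext f
      simp [LinearEquiv.congrLeft]
    rw [h1]
    exact (LinearEquiv.bijective (LinearEquiv.congrLeft K R
      (LinearMap.ringLmapEquivSelf R R K).symm)).comp hK.homothety_bijective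
  ext_eq_zero i hi := by
    obtain ⟨j, rfl⟩ : ∃ j, i = j + 1 := ⟨i - 1, by omega⟩
    have : Module.Projective R (ModuleCat.of R R) := inferInstanceAs (Module.Projective R R)
    infer_instance
  ext_dual_eq_zero i hi := by
    have := hK.ext_eq_zero i hi
    exact (extCongr (A := kDual K (ModuleCat.of R R)) (B := K)
      (LinearMap.ringLmapEquivSelf R R K).toModuleIso K i).symm.toEquiv.subsingleton

lemma isTotallyReflexive_of_subsingleton (A : ModuleCat.{u} R) [Subsingleton A] :
    IsTotallyReflexive K A where
  finite := inferInstance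
  eval_bijective := by
    have : Subsingleton (A →ₗ[R] K) := ⟨fun f g => LinearMap.ext fun x => by
      rw [Subsingleton.elim x 0, map_zero, map_zero]⟩
    have : Subsingleton ((A →ₗ[R] K) →ₗ[R] K) := ⟨fun f g => LinearMap.ext fun x => by
      rw [Subsingleton.elim x 0, map_zero, map_zero]⟩
    exact ⟨Function.injective_of_subsingleton _, fun x => ⟨0, Subsingleton.elim _ _⟩⟩
  ext_eq_zero i _ := subsingleton_ext_of_subsingleton A K i
  ext_dual_eq_zero i _ := by
    have : Subsingleton (A →ₗ[R] K) := ⟨fun f g => LinearMap.ext fun x => by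
      rw [Subsingleton.elim x 0, map_zero, map_zero]⟩
    exact subsingleton_ext_of_subsingleton (kDual K A) K i

lemma isTotallyReflexive_pi (hK : IsSemidualizing K) (n : ℕ) :
    IsTotallyReflexive K (ModuleCat.of R (Fin n → R)) := by
  induction n with
  | zero => exact isTotallyReflexive_of_subsingleton _
  | succ n ih =>
    have h := IsTotallyReflexive.ext (A := ModuleCat.of R R) (B := ModuleCat.of R (R × (Fin n → R)))
      (C := ModuleCat.of R (Fin n → R)) (isSES_prod R (Fin n → R)) (isTotallyReflexive_ring hK) ih
    exact h.of_equiv (B := ModuleCat.of R (Fin (n + 1) → R)) (Fin.consLinearEquiv R fun _ => R)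

lemma isResolving_isTotallyReflexive [IsNoetherianRing R] (hK : IsSemidualizing K) :
    IsResolving (IsTotallyReflexive K) where
  finite h := h.finite
  of_equiv e h := h.of_equiv e
  of_free A _ _ := by
    rcases subsingleton_or_nontrivial R with _ | _
    · have := Module.subsingleton R A
      exact isTotallyReflexive_of_subsingleton A
    · exact (isTotallyReflexive_pi hK _).of_equiv (Module.finBasis R A).equivFun.symm
  ext hs hA hC := .ext hs hA hC
  ker hs hB hC := .ker hs hB hC

/-! ### The `G_K`-dimension -/

lemma resDimLE_of_hasGKResolution {M : ModuleCat.{u} R} {m : ℕ} (h : HasGKResolution K M m) :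
    ResDimLE (IsTotallyReflexive K) m M := by
  induction m generalizing M with
  | zero =>
    obtain ⟨G, d, ε, h1, h2, h3, h4, h5⟩ := h
    refine (h1 0 le_rfl).of_equiv (LinearEquiv.ofBijective ε ⟨?_, h3⟩)
    rw [injective_iff_map_eq_zero]
    intro x hx
    obtain ⟨y, rfl⟩ := (h4 x).mp hx
    have := h2 1 one_pos
    rw [Subsingleton.elim y 0, map_zero]
  | succ m ih =>
    obtain ⟨G, d, ε, h1, h2, h3, h4, h5⟩ := h
    refine ⟨ModuleCat.of R (LinearMap.ker ε), G 0, _, ε, h1 0 (Nat.zero_le _), ih ?_, isSES_ker h3⟩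
    refine ⟨fun i => G (i + 1), fun i => d (i + 1),
      (d 0).codRestrict _ fun x => h4.apply_apply_eq_zero x, fun i hi => h1 _ (by omega),
      fun i hi => h2 _ (by omega), ?_, ?_, fun i => h5 (i + 1)⟩
    · rintro ⟨x, hx⟩
      obtain ⟨y, rfl⟩ := (h4 x).mp hx
      exact ⟨y, rfl⟩
    · intro x
      rw [Subtype.ext_iff]
      exact h5 0 x

lemma hasGKResolution_of_resDimLE {M : ModuleCat.{u} R} {m : ℕ}
    (h : ResDimLE (IsTotallyReflexive K) m M) : HasGKResolution K M m := by
  induction m generalizing M with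
  | zero =>
    refine ⟨fun | 0 => M | _ + 1 => ModuleCat.of R PUnit, fun | 0 => 0 | _ + 1 => 0,
      LinearMap.id, ?_, ?_, Function.surjective_id, ?_, ?_⟩
    · rintro i hi
      obtain rfl : i = 0 := by omega
      exact h
    · rintro (_ | i) hi
      · omega
      · exact inferInstanceAs (Subsingleton PUnit)
    · intro x
      simp [eq_comm]
    · intro i x
      exact ⟨fun _ => ⟨PUnit.unit, rfl⟩, fun _ => by cases i <;> rfl⟩
  | succ m ih =>
    obtain ⟨L, P, f, g, hP, hL, hs⟩ := h
    obtain ⟨G, d, ε, h1, h2, h3, h4, h5⟩ := ih hL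
    refine ⟨fun | 0 => P | i + 1 => G i, fun | 0 => f ∘ₗ ε | i + 1 => d i, g, ?_, ?_,
      hs.surjective, ?_, ?_⟩
    · rintro (_ | i) hi
      · exact hP
      · exact h1 i (by omega)
    · rintro (_ | i) hi
      · omega
      · exact h2 i (by omega)
    · intro x
      refine (hs.exact x).trans ⟨?_, ?_⟩
      · rintro ⟨y, rfl⟩
        obtain ⟨z, rfl⟩ := h3 y
        exact ⟨z, rfl⟩
      · rintro ⟨z, rfl⟩
        exact ⟨ε z, rfl⟩
    · rintro (_ | i)
      · intro x
        refine Iff.trans ?_ (h4 x)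
        exact map_eq_zero_iff f hs.injective
      · exact h5 i

lemma gkDim_le_iff [IsNoetherianRing R] (hK : IsSemidualizing K) {M : ModuleCat.{u} R} {m : ℕ} :
    gkDim K M ≤ m ↔ ResDimLE (IsTotallyReflexive K) m M := by
  constructor
  · intro h
    -- The strict bound extracts an actual resolution from the infimum; padding by zero then allows
    -- length m.
    have h1 : gkDim K M < ((m + 1 : ℕ) : ℕ∞) :=
      lt_of_le_of_lt h (by exact_mod_cast Nat.lt_succ_self m)
    simp only [gkDim, iInf_lt_iff] at h1
    obtain ⟨k, hk, hkm⟩ := h1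
    have hkm' : k ≤ m := Nat.lt_succ_iff.mp (by exact_mod_cast hkm)
    exact (resDimLE_of_hasGKResolution hk).mono (isResolving_isTotallyReflexive hK) hkm'
  · exact fun h => iInf₂_le m (hasGKResolution_of_resDimLE h)

end

/-! ### Even liaison classes -/

/-- A chain of even length splits into pairs of consecutive links, so an equivalence relation need
only be checked on one such pair. -/
lemma SameEvenLiaisonClass.of_equivalence {K : ModuleCat.{u} R} {n : ℕ}
    {𝒳 : ObjectProperty (ModuleCat.{u} R)} {P : ModuleCat.{u} R → ModuleCat.{u} R → Prop}
    (hP : Equivalence P)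
    (h : ∀ M N M', DirectlyLinked K n 𝒳 M N → DirectlyLinked K n 𝒳 N M' → P M M')
    {M N : ModuleCat.{u} R} (hMN : SameEvenLiaisonClass K n 𝒳 M N) : P M N := by
  refine (hP.eqvGen_iff).mp (Relation.EqvGen.mono (r := EvenlyLinked K n 𝒳) ?_ M N hMN)
  rintro M N ⟨m, -, ⟨k, rfl⟩, L, rfl, rfl, hL⟩
  have key : ∀ j ≤ k, P (L 0) (L (j + j)) := by
    intro j
    induction j with
    | zero => exact fun _ => hP.refl _
    | succ j ih =>
      intro hj
      have h1 := hL (j + j) (by omega)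
      have h2 := hL (j + j + 1) (by omega)
      have h3 := hP.trans (ih (by omega)) (h _ _ _ h1 h2)
      rwa [show j + j + 1 + 1 = j + 1 + (j + 1) by omega] at h3
  exact key k le_rfl

/-- What two modules that are linked in two steps have in common: they are quotients of modules
in the subcategory by isomorphic modules, and have the same `Ext^i(-, K)` for `i > n`. -/
structure DoublyLinked (K : ModuleCat.{u} R) (n : ℕ) (𝒳 : ObjectProperty (ModuleCat.{u} R))
    (M M' : ModuleCat.{u} R) : Prop where
  exists_presentation : ∃ (X X' : ModuleCat.{u} R) (φ : X ⟶ M) (φ' : X' ⟶ M'),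
    MemEpi 𝒳 φ ∧ MemEpi 𝒳 φ' ∧ Nonempty (LinearMap.ker φ.hom ≃ₗ[R] LinearMap.ker φ'.hom)
  nonempty_ext_equiv : ∀ i, n < i → Nonempty (Ext M K i ≃ₗ[R] Ext M' K i)

lemma DoublyLinked.symm {K : ModuleCat.{u} R} {n : ℕ} {𝒳 : ObjectProperty (ModuleCat.{u} R)}
    {M M' : ModuleCat.{u} R} (h : DoublyLinked K n 𝒳 M M') : DoublyLinked K n 𝒳 M' M where
  exists_presentation := by
    obtain ⟨X, X', φ, φ', h1, h2, ⟨e⟩⟩ := h.exists_presentation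
    exact ⟨X', X, φ', φ, h2, h1, ⟨e.symm⟩⟩
  nonempty_ext_equiv i hi := (h.nonempty_ext_equiv i hi).map LinearEquiv.symm

/-- All that is used of the subcategory is that its modules are finite with Ext(-, K) concentrated
in degree n. -/
lemma DirectlyLinked.doublyLinked [IsNoetherianRing R] {K : ModuleCat.{u} R} [Module.Finite R K]
    {n : ℕ} {𝒳 : ObjectProperty (ModuleCat.{u} R)}
    (h𝒳 : ∀ X, 𝒳 X → Module.Finite R X ∧ ∀ i, i ≠ n → Subsingleton (Ext X K i))
    {M N M' : ModuleCat.{u} R} (h : DirectlyLinked K n 𝒳 M N) (h' : DirectlyLinked K n 𝒳 N M') :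
    DoublyLinked K n 𝒳 M M' := by
  obtain ⟨X, Y, φ, ψ, hφ, hψ, h1, h2⟩ := h
  obtain ⟨Y', X', ψ', φ', hψ', hφ', h3, h4⟩ := h'
  have := (h𝒳 Y hψ.source_mem).1
  have := (h𝒳 Y' hψ'.source_mem).1
  obtain ⟨h5, h6⟩ := nonempty_equivs_of_linked hφ.surjective hψ.surjective hφ'.surjective
    hψ'.surjective h1 h2 h4 h3
    (fun i hi => (h𝒳 X hφ.source_mem).2 i hi.ne')
    (fun i hi => (h𝒳 X' hφ'.source_mem).2 i hi.ne')
    (fun i hi => (h𝒳 Y hψ.source_mem).2 i hi.ne)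
    (fun i hi => (h𝒳 Y' hψ'.source_mem).2 i hi.ne)
  exact ⟨⟨X, X', φ, φ', hφ, hφ', h5⟩, h6⟩

lemma nontrivial_of_grade_eq {M : ModuleCat.{u} R} {n : ℕ} (h : grade M = n) : Nontrivial M := by
  by_contra hM
  rw [not_nontrivial_iff_subsingleton] at hM
  have : grade M = ⊤ := by
    simp only [grade, iInf_eq_top]
    intro i hi
    have := subsingleton_ext_of_subsingleton M (ModuleCat.of R R) i
    exact absurd hi (not_nontrivial _)
  rw [this] at h
  exact ENat.natCast_ne_top n h.symm

/-! ### Invariance of the G_K-dimension -/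

section GK

variable [IsNoetherianRing R] {K : ModuleCat.{u} R} (hK : IsSemidualizing K) {n : ℕ}
include hK

lemma IsTotallyReflexive.resDimLE_of_subsingleton_ext {m : ℕ} {M : ModuleCat.{u} R}
    (h : ResDimLE (IsTotallyReflexive K) m M) {r : ℕ}
    (hM : ∀ i, r < i → Subsingleton (Ext M K i)) : ResDimLE (IsTotallyReflexive K) r M := by
  rcases le_total m r with hr | hr
  · exact h.mono (isResolving_isTotallyReflexive hK) hr
  · exact h.of_subsingleton_ext (fun A hA => hA.ext_eq_zero) (fun hs hA hB hC => hA.coker hs hB hC)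
      hr hM

/-- If the dimension were below the grade, every Ext^i(M, K) would vanish. Then M would be totally
reflexive with zero dual, hence zero, contrary to its finite grade. -/
lemma grade_le_gkDim {M : ModuleCat.{u} R} [Module.Finite R M] (hM : grade M = n) :
    (n : ℕ∞) ≤ gkDim K M := by
  rw [← not_lt]
  intro hlt
  obtain ⟨m, hm⟩ := ENat.ne_top_iff_exists.mp (hlt.ne_top)
  have hmn : m < n := by rw [← hm] at hlt; exact_mod_cast hlt
  have hres := (gkDim_le_iff hK).mp hm.ge
  have hlow := hK.subsingleton_ext_of_lt_grade M hM.ge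
  have hhigh := hres.subsingleton_ext (fun A hA => hA.ext_eq_zero)
  have h0 : IsTotallyReflexive K M :=
    IsTotallyReflexive.resDimLE_of_subsingleton_ext hK hres (r := 0) fun i _ => by
      rcases lt_or_ge m i with h | h
      · exact hhigh i h
      · exact hlow i (by omega)
  have := hlow 0 (by omega)
  have hsub : Subsingleton (M →ₗ[R] K) := (extZeroEquiv M K).symm.toEquiv.subsingleton
  have hM' := nontrivial_of_grade_eq hM
  obtain ⟨x, hx⟩ := exists_ne (0 : M)
  refine hx (h0.eval_bijective.1 (LinearMap.ext fun f => ?_))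
  rw [Subsingleton.elim f 0, map_zero, map_zero]

lemma gkPerfect_subsingleton_ext (X : ModuleCat.{u} R) (hX : gkPerfect K n X) :
    Module.Finite R X ∧ ∀ i, i ≠ n → Subsingleton (Ext X K i) := by
  obtain ⟨h1, h2, h3⟩ := hX
  refine ⟨h1, fun i hi => ?_⟩
  rcases lt_or_gt_of_ne hi with h | h
  · exact hK.subsingleton_ext_of_lt_grade X h2.ge i h
  · exact ((gkDim_le_iff hK).mp h3.le).subsingleton_ext (fun A hA => hA.ext_eq_zero) i h

lemma DoublyLinked.gkDim_le {M M' : ModuleCat.{u} R} (h : DoublyLinked K n (gkPerfect K n) M M') :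
    gkDim K M' ≤ gkDim K M := by
  obtain ⟨⟨X, X', φ, φ', hφ, hφ', ⟨e⟩⟩, hext⟩ := h
  have hG := isResolving_isTotallyReflexive hK
  have := hφ.finite
  rcases eq_or_ne (gkDim K M) ⊤ with htop | htop
  · rw [htop]; exact le_top
  obtain ⟨m, hm⟩ := ENat.ne_top_iff_exists.mp htop
  -- This bounds the dimensions of X and X' by m, and places every degree i > m in the range i > n
  -- where Ext is compared.
  have hnm : n ≤ m := by
    have := grade_le_gkDim hK (hφ.grade_eq.trans hφ.source_mem.2.1)
    rw [← hm] at this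
    exact_mod_cast this
  have hM := (gkDim_le_iff hK).mp hm.ge
  have hX := ((gkDim_le_iff hK).mp hφ.source_mem.2.2.le).mono hG hnm
  have hX' := ((gkDim_le_iff hK).mp hφ'.source_mem.2.2.le).mono hG hnm
  have hker := ResDimLE.ker_of_coker hG (A := ModuleCat.of R (LinearMap.ker φ.hom))
    (isSES_ker hφ.surjective) hX hM
  have hM' := ResDimLE.coker hG (A := ModuleCat.of R (LinearMap.ker φ'.hom))
    (isSES_ker hφ'.surjective) (hker.of_equiv hG e) hX'
  rw [← hm, gkDim_le_iff hK]
  refine IsTotallyReflexive.resDimLE_of_subsingleton_ext hK hM' fun i hi => ?_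
  obtain ⟨e'⟩ := hext i (by omega)
  have := hM.subsingleton_ext (fun A hA => hA.ext_eq_zero) i hi
  exact e'.symm.toEquiv.subsingleton

end GK

/-! ### Invariance of the projective dimension -/

section Pd

open Limits

lemma exists_retract_pi (L : ModuleCat.{u} R) [Module.Finite R L] [Module.Projective R L] :
    ∃ (k : ℕ) (i : L →ₗ[R] (Fin k → R)) (p : (Fin k → R) →ₗ[R] L), p ∘ₗ i = LinearMap.id := by
  obtain ⟨k, p, hp⟩ := Module.Finite.exists_fin' R L
  obtain ⟨i, hi⟩ := Module.projective_lifting_property p LinearMap.id hp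
  exact ⟨k, i, p, hi⟩

lemma projective_iff_hasProjectiveDimensionLT_one' {M : ModuleCat.{u} R} :
    Module.Projective R M ↔ HasProjectiveDimensionLT M 1 := by
  rw [← projective_iff_hasProjectiveDimensionLT_one]
  exact IsProjective.iff_projective (R := R) M

/-- L is a retract of some R^k, and the coordinate functions L → R extend to P since Ext^1(M, R) =
0. Thus f has a retraction and M is a summand of P. -/
lemma projective_of_isSES {L P M : ModuleCat.{u} R} [Module.Finite R L] [Module.Projective R L]
    [Module.Projective R P] {f : L →ₗ[R] P} {g : P →ₗ[R] M} (hs : IsSES f g)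
    (h : Subsingleton (Ext M (ModuleCat.of R R) 1)) : Module.Projective R M := by
  obtain ⟨k, i, p, hip⟩ := exists_retract_pi L
  choose y hy using fun j : Fin k =>
    exists_extension_of_subsingleton_ext hs h (LinearMap.proj j ∘ₗ i)
  have hr : (p ∘ₗ LinearMap.pi y) ∘ₗ f = LinearMap.id := by
    rw [LinearMap.comp_assoc, ← hip]
    congr 1
    ext a j
    exact LinearMap.congr_fun (hy j) a
  let e := (hs.exact.splitInjectiveEquiv hs.surjective ⟨_, hr⟩).1
  have : Module.Projective R (L × M) := Module.Projective.of_equiv e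
  exact Module.Projective.of_split (LinearMap.inr R L M) (LinearMap.snd R L M)
    (LinearMap.snd_comp_inr R L M)

variable [IsNoetherianRing R]

/-- Induction along syzygies of free covers; finiteness of M allows testing with Ext into R alone.
The conclusion `r + 1` means dimension at most r. -/
lemma HasProjectiveDimensionLT.of_subsingleton_ext {M : ModuleCat.{u} R} [Module.Finite R M]
    {m : ℕ} (h : HasProjectiveDimensionLT M m) {r : ℕ}
    (hM : ∀ i, r < i → Subsingleton (Ext M (ModuleCat.of R R) i)) :
    HasProjectiveDimensionLT M (r + 1) := by
  induction m generalizing M r with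
  | zero => exact hasProjectiveDimensionLT_of_ge M 0 _ (Nat.zero_le _)
  | succ m ih =>
    rcases Nat.eq_zero_or_pos m with rfl | hm
    · exact hasProjectiveDimensionLT_of_ge M 1 _ (by omega)
    obtain ⟨P, p, _, _, hp⟩ := exists_free_cover M
    have hs := isSES_ker hp
    have hS := IsSES.shortExact (A := ModuleCat.of R (LinearMap.ker p)) hs
    have hP : HasProjectiveDimensionLT P 1 :=
      projective_iff_hasProjectiveDimensionLT_one'.mp inferInstance
    have hP' : ∀ k, 0 < k → HasProjectiveDimensionLT P k := fun k hk =>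
      hasProjectiveDimensionLT_of_ge P 1 _ hk
    have hL : HasProjectiveDimensionLT (ModuleCat.of R (LinearMap.ker p)) m :=
      hS.hasProjectiveDimensionLT_X₁ m (hP' m hm) h
    have hsub : ∀ i, 0 < i → r < i + 1 →
        Subsingleton (Ext (ModuleCat.of R (LinearMap.ker p)) (ModuleCat.of R R) i) := by
      intro i hi hri
      obtain ⟨j, rfl⟩ : ∃ j, i = j + 1 := ⟨i - 1, by omega⟩
      exact subsingleton_ext_X₁ hS _ (subsingleton_ext_of_projective P _ j) (hM _ hri)
    cases r with
    | zero =>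
      -- Here r cannot drop: the syzygy is already projective, and the vanishing of Ext^1(M, R)
      -- splits the cover.
      have h1 := ih (r := 0) hL fun i hi => hsub i hi (by omega)
      have : Module.Projective R (ModuleCat.of R (LinearMap.ker p)) :=
        projective_iff_hasProjectiveDimensionLT_one'.mpr h1
      exact projective_iff_hasProjectiveDimensionLT_one'.mp
        (projective_of_isSES (L := ModuleCat.of R (LinearMap.ker p)) hs (hM 1 one_pos))
    | succ r =>
      have h1 := ih (r := r) hL fun i hi => hsub i (by omega) (by omega)
      exact hS.hasProjectiveDimensionLT_X₃ (r + 1) h1 (hP' _ (by omega))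

/-- Such an M is projective with zero dual, but it embeds in some R^k, whose coordinate functions
all vanish on it. -/
lemma subsingleton_of_subsingleton_ext {M : ModuleCat.{u} R} [Module.Finite R M] {m : ℕ}
    (h : HasProjectiveDimensionLT M m)
    (hM : ∀ i, Subsingleton (Ext M (ModuleCat.of R R) i)) : Subsingleton M := by
  have h1 := HasProjectiveDimensionLT.of_subsingleton_ext h (r := 0) fun i _ => hM i
  have : Module.Projective R M := projective_iff_hasProjectiveDimensionLT_one'.mpr h1
  obtain ⟨k, i, p, hip⟩ := exists_retract_pi M
  have := hM 0
  have hsub : Subsingleton (M →ₗ[R] R) :=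
    (extZeroEquiv M (ModuleCat.of R R)).symm.toEquiv.subsingleton
  have hi : i = 0 := by
    ext x j
    exact LinearMap.congr_fun (Subsingleton.elim (LinearMap.proj j ∘ₗ i) 0) x
  refine subsingleton_of_forall_eq 0 fun x => ?_
  have := LinearMap.congr_fun hip x
  simpa [hi] using this.symm

variable {n : ℕ}

omit [IsNoetherianRing R] in
lemma perfect_subsingleton_ext (X : ModuleCat.{u} R) (hX : perfect n X) :
    Module.Finite R X ∧ ∀ i, i ≠ n → Subsingleton (Ext X (ModuleCat.of R R) i) := by
  obtain ⟨h1, h2, h3⟩ := hX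
  refine ⟨h1, fun i hi => ?_⟩
  rcases lt_or_gt_of_ne hi with h | h
  · exact subsingleton_ext_of_lt_grade (by rw [h2]; exact_mod_cast h)
  · have := (projectiveDimension_le_iff X n).mp h3.le
    exact HasProjectiveDimensionLT.subsingleton X (n + 1) i h _

lemma grade_lt_of_hasProjectiveDimensionLT {M : ModuleCat.{u} R} [Module.Finite R M]
    (hM : grade M = n) {m : ℕ} (h : HasProjectiveDimensionLT M m) : n < m := by
  by_contra! hmn
  have hM' := nontrivial_of_grade_eq hM
  refine not_subsingleton M (subsingleton_of_subsingleton_ext h fun i => ?_)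
  rcases lt_or_ge i n with hi | hi
  · exact subsingleton_ext_of_lt_grade (by rw [hM]; exact_mod_cast hi)
  · exact HasProjectiveDimensionLT.subsingleton M m i (by omega) _

lemma DoublyLinked.projectiveDimension_le {M M' : ModuleCat.{u} R}
    (h : DoublyLinked (ModuleCat.of R R) n (perfect n) M M') :
    projectiveDimension M' ≤ projectiveDimension M := by
  obtain ⟨⟨X, X', φ, φ', hφ, hφ', ⟨e⟩⟩, hext⟩ := h
  have := hφ.finite
  have := hφ'.finite
  have hgr := hφ.grade_eq.trans hφ.source_mem.2.1
  -- The values lie in `WithBot ℕ∞`: ⊥ is excluded because finite grade makes M nonzero, and ⊤ is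
  -- trivial.
  refine le_of_forall_ge fun N hN => ?_
  induction N with
  | bot =>
    rw [le_bot_iff, projectiveDimension_eq_bot_iff, ModuleCat.isZero_iff_subsingleton] at hN
    have := nontrivial_of_grade_eq hgr
    exact absurd hN (not_subsingleton M)
  | coe N =>
    induction N with
    | top => exact le_top
    | coe m =>
      have hM := (projectiveDimension_le_iff M m).mp hN
      have hnm := grade_lt_of_hasProjectiveDimensionLT hgr hM
      refine (projectiveDimension_le_iff M' m).mpr ?_
      have hX := (projectiveDimension_le_iff X n).mp hφ.source_mem.2.2.le
      have hX' := (projectiveDimension_le_iff X' n).mp hφ'.source_mem.2.2.le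
      have hS := shortExact_kerIncl φ hφ.surjective
      have hS' := shortExact_kerIncl φ' hφ'.surjective
      have hker : HasProjectiveDimensionLT (ModuleCat.of R (LinearMap.ker φ.hom)) (m + 1) :=
        hS.hasProjectiveDimensionLT_X₁ (m + 1) (hasProjectiveDimensionLT_of_ge X (n + 1) _ hnm)
          (hasProjectiveDimensionLT_of_ge M (m + 1) _ (by omega))
      have hker' : HasProjectiveDimensionLT (ModuleCat.of R (LinearMap.ker φ'.hom)) (m + 1) :=
        hasProjectiveDimensionLT_of_iso e.toModuleIso (m + 1)
      have hM' := hS'.hasProjectiveDimensionLT_X₃ (m + 1) hker'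
        (hasProjectiveDimensionLT_of_ge X' (n + 1) _ (by omega))
      refine HasProjectiveDimensionLT.of_subsingleton_ext hM' fun i hi => ?_
      obtain ⟨e'⟩ := hext i (by omega)
      have := HasProjectiveDimensionLT.subsingleton M (m + 1) i hi (ModuleCat.of R R)
      exact e'.symm.toEquiv.subsingleton

end Pd

end ModuleLinkage

namespace ModuleLinkage

/-! ### Flat base change followed by restriction along a deformation -/

section Deformation

open scoped TensorProduct

variable {R : Type u} (R' Q : Type u) [CommRing R] [CommRing R'] [CommRing Q] [Algebra R R']
  [Algebra Q R'] [SMulCommClass R Q R']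

/-- The `Q`-module `R' ⊗ M`. -/
abbrev deform (M : ModuleCat.{u} R) : ModuleCat.{u} Q := ModuleCat.of Q (R' ⊗[R] M)

/-- The map `R' ⊗ f`. -/
noncomputable def deformMap {M N : ModuleCat.{u} R} (f : M →ₗ[R] N) :
    deform R' Q M →ₗ[Q] deform R' Q N :=
  (f.baseChange R').restrictScalars Q

variable {R' Q}

lemma deformMap_comp {L M N : ModuleCat.{u} R} (g : M →ₗ[R] N) (f : L →ₗ[R] M) :
    deformMap R' Q (g ∘ₗ f) = deformMap R' Q g ∘ₗ deformMap R' Q f := by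
  ext x
  simp only [deformMap, LinearMap.baseChange_comp, LinearMap.coe_restrictScalars,
    LinearMap.comp_apply]

lemma deformMap_id {M : ModuleCat.{u} R} :
    deformMap R' Q (LinearMap.id : M →ₗ[R] M) = LinearMap.id := by
  ext x
  simp [deformMap]

/-- `R' ⊗ -` on isomorphisms. -/
noncomputable def deformEquiv {M N : ModuleCat.{u} R} (e : M ≃ₗ[R] N) :
    deform R' Q M ≃ₗ[Q] deform R' Q N :=
  LinearEquiv.ofLinearMap (deformMap R' Q e.toLinearMap) (deformMap R' Q e.symm.toLinearMap)
    (by rw [← deformMap_comp]; simp [deformMap_id]) (by rw [← deformMap_comp]; simp [deformMap_id])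

lemma IsSES.deformMap [Module.Flat R R'] {A B C : ModuleCat.{u} R} {f : A →ₗ[R] B} {g : B →ₗ[R] C}
    (hs : IsSES f g) : IsSES (deformMap R' Q f) (deformMap R' Q g) :=
  ⟨Module.Flat.lTensor_preserves_injective_linearMap f hs.injective,
    lTensor_exact R' hs.exact hs.surjective, LinearMap.lTensor_surjective R' hs.surjective⟩

variable (hQ : Function.Surjective (algebraMap Q R'))

include hQ in
lemma finite_deform (M : ModuleCat.{u} R) [Module.Finite R M] :
    Module.Finite Q (deform R' Q M) := by
  have : Module.Finite Q R' := Module.Finite.of_surjective (Algebra.linearMap Q R') hQ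
  exact Module.Finite.trans R' (R' ⊗[R] M)

lemma killedBy_deform {rs : List Q} (hrs : ∀ r ∈ rs, algebraMap Q R' r = 0) (M : ModuleCat.{u} R) :
    KilledBy rs (deform R' Q M) := by
  refine fun r hr => Module.mem_annihilator.mpr fun x => ?_
  change r • x = 0
  rw [← algebraMap_smul R' r x, hrs r hr, zero_smul]

/-! ### Projective dimension after deformation -/

section Pd

variable {c : ℕ} (hc : HasProjectiveDimensionLT (deform R' Q (ModuleCat.of R R)) (c + 1))
include hc

lemma hasProjectiveDimensionLT_deform_pi [Module.Flat R R'] (k : ℕ) :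
    HasProjectiveDimensionLT (deform R' Q (ModuleCat.of R (Fin k → R))) (c + 1) := by
  induction k with
  | zero =>
    have h0 : Limits.IsZero (deform R' Q (ModuleCat.of R (Fin 0 → R))) := by
      rw [ModuleCat.isZero_iff_subsingleton]
      exact inferInstanceAs (Subsingleton (R' ⊗[R] (Fin 0 → R)))
    have := h0.hasProjectiveDimensionLT_zero
    exact hasProjectiveDimensionLT_of_ge _ 0 _ (Nat.zero_le _)
  | succ k ih =>
    have hs := (IsSES.deformMap (R' := R') (Q := Q) (A := ModuleCat.of R R)
      (B := ModuleCat.of R (R × (Fin k → R))) (C := ModuleCat.of R (Fin k → R))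
      (isSES_prod R (Fin k → R))).shortExact
    have h1 := hs.hasProjectiveDimensionLT_X₂ (c + 1) hc ih
    have e := deformEquiv (R' := R') (Q := Q) (M := ModuleCat.of R (R × (Fin k → R)))
      (N := ModuleCat.of R (Fin (k + 1) → R)) (Fin.consLinearEquiv R fun _ => R)
    exact @hasProjectiveDimensionLT_of_iso _ _ _ _ _ e.toModuleIso (c + 1) h1

lemma hasProjectiveDimensionLT_deform_of_projective [Module.Flat R R'] (P : ModuleCat.{u} R)
    [Module.Finite R P] [Module.Projective R P] :
    HasProjectiveDimensionLT (deform R' Q P) (c + 1) := by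
  obtain ⟨k, i, p, hip⟩ := exists_retract_pi P
  have := hasProjectiveDimensionLT_deform_pi hc k
  refine Retract.hasProjectiveDimensionLT (Y := deform R' Q (ModuleCat.of R (Fin k → R)))
    ⟨ModuleCat.ofHom (deformMap R' Q (N := ModuleCat.of R (Fin k → R)) i),
      ModuleCat.ofHom (deformMap R' Q (M := ModuleCat.of R (Fin k → R)) p), ?_⟩ (c + 1)
  rw [← ModuleCat.ofHom_comp, ← deformMap_comp]
  ext x
  exact LinearMap.congr_fun ((congrArg (deformMap R' Q) hip).trans deformMap_id) x

/-- By flatness a syzygy over R gives a syzygy sequence over Q, each step costing one, and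
projectives start at dimension at most c. -/
lemma hasProjectiveDimensionLT_deform [Module.Flat R R'] [IsNoetherianRing R] {n : ℕ}
    {X : ModuleCat.{u} R} [Module.Finite R X] (h : HasProjectiveDimensionLT X (n + 1)) :
    HasProjectiveDimensionLT (deform R' Q X) (n + c + 1) := by
  induction n generalizing X with
  | zero =>
    have : Module.Projective R X := projective_iff_hasProjectiveDimensionLT_one'.mpr h
    rw [zero_add]
    exact hasProjectiveDimensionLT_deform_of_projective hc X
  | succ n ih =>
    obtain ⟨P, p, _, _, hp⟩ := exists_free_cover X
    have hs := isSES_ker hp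
    have hS := IsSES.shortExact (A := ModuleCat.of R (LinearMap.ker p)) hs
    have hP : HasProjectiveDimensionLT P 1 :=
      projective_iff_hasProjectiveDimensionLT_one'.mp inferInstance
    have h1 : HasProjectiveDimensionLT (ModuleCat.of R (LinearMap.ker p)) (n + 1) :=
      hS.hasProjectiveDimensionLT_X₁ _ (hasProjectiveDimensionLT_of_ge P 1 _ (by omega)) h
    have h2 := hasProjectiveDimensionLT_deform_of_projective hc P
    have h3 := (IsSES.deformMap (R' := R') (Q := Q) (A := ModuleCat.of R (LinearMap.ker p))
      hs).shortExact.hasProjectiveDimensionLT_X₃ (n + c + 1) (ih h1)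
      (hasProjectiveDimensionLT_of_ge _ (c + 1) _ (by omega))
    rwa [show n + 1 + c + 1 = n + c + 1 + 1 by omega]

end Pd

/-! ### Comparison of Ext over Q with Ext over R -/

section ExtDeform

variable {rs : List Q} (hrs : ∀ r ∈ rs, algebraMap Q R' r = 0) {c : ℕ}
  {B : ModuleCat.{u} Q} (D : ExtDuality rs (ModuleCat.of Q Q) c B)
  (eB : deform R' Q (ModuleCat.of R R) ≃ₗ[Q] B) [Module.Flat R R'] [IsNoetherianRing R]

/-- `R' ⊗ Hom_R(M, R) ≅ Ext_Q^c(R' ⊗ M, Q)`. -/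
noncomputable def tensorDualEquivExt (M : ModuleCat.{u} R) [Module.Finite R M] :
    R' ⊗[R] (M →ₗ[R] R) ≃+ Ext (deform R' Q M) (ModuleCat.of Q Q) c :=
  have : Module.FinitePresentation R M := Module.finitePresentation_of_finite R M
  -- Hom out of a finitely presented module commutes with flat base change; R'-linear and Q-linear
  -- maps agree as Q → R' is onto; then R' ⊗ R ≅ B and the duality D apply.
  (Module.FinitePresentation.isBaseChange_map R M R R').equiv.toAddEquiv.trans
    ((LinearMap.extendScalarsOfSurjectiveEquiv (M := R' ⊗[R] M) (N := R' ⊗[R] R)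
      hQ).symm.toAddEquiv.trans
    ((LinearEquiv.congrRight (M₂ := R' ⊗[R] R) (M₃ := B) (M := R' ⊗[R] M) eB).toAddEquiv.trans
      (D.equiv (deform R' Q M) (killedBy_deform hrs M)).symm.toAddEquiv))

omit [IsNoetherianRing R] in
lemma isBaseChange_map_equiv_naturality {L M : ModuleCat.{u} R} [Module.FinitePresentation R L]
    [Module.FinitePresentation R M] (f : L →ₗ[R] M) (x : R' ⊗[R] (M →ₗ[R] R)) :
    (Module.FinitePresentation.isBaseChange_map R L R R').equiv
        ((LinearMap.lcomp R R f).lTensor R' x) =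
      (Module.FinitePresentation.isBaseChange_map R M R R').equiv x ∘ₗ f.baseChange R' := by
  induction x with
  | zero => simp
  | add x y hx hy => rw [map_add, map_add, hx, hy, map_add, LinearMap.add_comp]
  | tmul s h =>
    rw [LinearMap.lTensor_tmul, IsBaseChange.equiv_tmul, IsBaseChange.equiv_tmul]
    ext a
    simp

/-- Naturality is needed to compare cokernels in degree one. -/
lemma tensorDualEquivExt_naturality {L M : ModuleCat.{u} R} [Module.Finite R L]
    [Module.Finite R M] (f : L →ₗ[R] M) (x : R' ⊗[R] (M →ₗ[R] R)) :
    tensorDualEquivExt hQ hrs D eB L ((LinearMap.lcomp R R f).lTensor R' x) =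
      extMap (ModuleCat.of Q Q) c (ModuleCat.ofHom (deformMap R' Q f))
        (tensorDualEquivExt hQ hrs D eB M x) := by
  have : Module.FinitePresentation R L := Module.finitePresentation_of_finite R L
  have : Module.FinitePresentation R M := Module.finitePresentation_of_finite R M
  refine (D.equiv _ (killedBy_deform hrs L)).injective ?_
  rw [D.natural (killedBy_deform hrs L) (killedBy_deform hrs M)]
  refine ((D.equiv _ (killedBy_deform hrs L)).apply_symm_apply _).trans ?_
  refine Eq.trans ?_ (congrArg (fun z => LinearMap.comp z (deformMap R' Q f))
    ((D.equiv _ (killedBy_deform hrs M)).apply_symm_apply _)).symm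
  refine LinearMap.ext fun y => ?_
  exact congrArg eB (LinearMap.congr_fun (isBaseChange_map_equiv_naturality f x) y)

include hQ hrs D eB in
lemma subsingleton_ext_deform_zero_iff (M : ModuleCat.{u} R) [Module.Finite R M] :
    Subsingleton (Ext (deform R' Q M) (ModuleCat.of Q Q) c) ↔
      Subsingleton (R' ⊗[R] Ext M (ModuleCat.of R R) 0) :=
  (tensorDualEquivExt hQ hrs D eB M).symm.toEquiv.subsingleton_congr.trans
    (TensorProduct.congr (LinearEquiv.refl R R')
      (extZeroEquiv M (ModuleCat.of R R))).symm.toEquiv.subsingleton_congr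

omit [Module.Flat R R'] [IsNoetherianRing R] in
lemma subsingleton_tensor_coker_iff {A C : Type u} [AddCommGroup A] [AddCommGroup C] [Module R A]
    [Module R C] (f : A →ₗ[R] C) :
    Subsingleton (R' ⊗[R] (C ⧸ LinearMap.range f)) ↔ Function.Surjective (f.lTensor R') := by
  have h1 := lTensor_exact R' (LinearMap.exact_map_mkQ_range f) (Submodule.mkQ_surjective _)
  have h2 := LinearMap.lTensor_surjective R' (Submodule.mkQ_surjective (LinearMap.range f))
  constructor
  · intro h x
    exact (h1 x).mp (Subsingleton.elim _ _)
  · refine fun h => subsingleton_of_forall_eq 0 fun x => ?_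
    obtain ⟨y, rfl⟩ := h2 x
    exact (h1 y).mpr (h y)

variable (hc : HasProjectiveDimensionLT (deform R' Q (ModuleCat.of R R)) (c + 1))

omit [IsNoetherianRing R] in
include hc in
lemma subsingleton_ext_deform_of_projective (P : ModuleCat.{u} R)
    [Module.Finite R P] [Module.Projective R P] (i : ℕ) :
    Subsingleton (Ext (deform R' Q P) (ModuleCat.of Q Q) (c + i + 1)) :=
  have := hasProjectiveDimensionLT_deform_of_projective hc P
  HasProjectiveDimensionLT.subsingleton _ (c + 1) _ (by omega) _

include hQ hrs D eB hc in
-- With L the kernel of a free cover P → M, both Ext modules are cokernels of maps induced by L → P.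
-- Since R' ⊗ - is right exact, either side vanishes exactly when R' ⊗ Hom(P, R) → R' ⊗ Hom(L, R) is
-- onto.
lemma subsingleton_ext_deform_one_iff (M : ModuleCat.{u} R) [Module.Finite R M] :
    Subsingleton (Ext (deform R' Q M) (ModuleCat.of Q Q) (c + 1)) ↔
      Subsingleton (R' ⊗[R] Ext M (ModuleCat.of R R) 1) := by
  obtain ⟨P, p, _, _, hp⟩ := exists_free_cover M
  let L := ModuleCat.of R (LinearMap.ker p)
  have hs : IsSES (A := L) (LinearMap.ker p).subtype p := isSES_ker hp
  have e₁ := extCokerEquiv (IsSES.shortExact (A := L) hs) (ModuleCat.of R R) (i := 0)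
    (subsingleton_ext_of_projective P _ 0)
  have e₂ := extCokerEquiv (IsSES.deformMap (R' := R') (Q := Q) (A := L) hs).shortExact (ModuleCat.of Q Q)
    (subsingleton_ext_deform_of_projective hc P 0)
  have e₃ : (Ext L (ModuleCat.of R R) 0 ⧸ LinearMap.range (extMap (ModuleCat.of R R) 0
      (ModuleCat.ofHom (X := L) (Y := P) (LinearMap.ker p).subtype))) ≃ₗ[R]
      (L →ₗ[R] R) ⧸ LinearMap.range (LinearMap.lcomp R R (LinearMap.ker p).subtype) := by
    refine Submodule.Quotient.equiv _ _ (extZeroEquiv L (ModuleCat.of R R)) ?_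
    ext F
    simp only [Submodule.mem_map, LinearMap.mem_range]
    constructor
    · rintro ⟨_, ⟨x, rfl⟩, rfl⟩
      exact ⟨extZeroEquiv P _ x, (extZeroEquiv_extMap (A := L) (B := P)
        (ModuleCat.ofHom (LinearMap.ker p).subtype) x).symm⟩
    · rintro ⟨f, rfl⟩
      refine ⟨_, ⟨(extZeroEquiv P (ModuleCat.of R R)).symm f, rfl⟩, ?_⟩
      refine (extZeroEquiv_extMap (A := L) (B := P) (ModuleCat.ofHom (LinearMap.ker p).subtype)
        _).trans ?_
      rw [LinearEquiv.apply_symm_apply]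
      rfl
  rw [← (TensorProduct.congr (LinearEquiv.refl R R')
      (e₃.symm.trans e₁)).toEquiv.subsingleton_congr, subsingleton_tensor_coker_iff,
    ← e₂.toEquiv.subsingleton_congr]
  refine Submodule.Quotient.subsingleton_iff.trans (LinearMap.range_eq_top.trans ?_)
  have hnat := tensorDualEquivExt_naturality hQ hrs D eB (L := L) (LinearMap.ker p).subtype
  constructor
  · intro h x
    obtain ⟨y, hy⟩ := h (tensorDualEquivExt hQ hrs D eB L x)
    obtain ⟨z, rfl⟩ := (tensorDualEquivExt hQ hrs D eB P).surjective y
    exact ⟨z, (tensorDualEquivExt hQ hrs D eB L).injective ((hnat z).trans hy)⟩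
  · intro h y
    obtain ⟨x, rfl⟩ := (tensorDualEquivExt hQ hrs D eB L).surjective y
    obtain ⟨z, rfl⟩ := h x
    exact ⟨tensorDualEquivExt hQ hrs D eB P z, (hnat z).symm⟩

include hQ hrs D eB hc in
/-- `Ext_Q^{c+i}(R' ⊗ M, Q)` vanishes if and only if `R' ⊗ Ext_R^i(M, R)` does. -/
lemma subsingleton_ext_deform_iff (M : ModuleCat.{u} R) [Module.Finite R M] (i : ℕ) :
    Subsingleton (Ext (deform R' Q M) (ModuleCat.of Q Q) (c + i)) ↔
      Subsingleton (R' ⊗[R] Ext M (ModuleCat.of R R) i) := by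
  induction i generalizing M with
  | zero => exact subsingleton_ext_deform_zero_iff hQ hrs D eB M
  | succ i ih =>
    -- Degree one is separate: Hom(P, R) need not vanish, so dimension shifting is available only
    -- from degree two on.
    rcases i with _ | i
    · exact subsingleton_ext_deform_one_iff hQ hrs D eB hc M
    obtain ⟨P, p, _, _, hp⟩ := exists_free_cover M
    let L := ModuleCat.of R (LinearMap.ker p)
    have hs : IsSES (A := L) (LinearMap.ker p).subtype p := isSES_ker hp
    have e₁ := extShiftEquiv (IsSES.shortExact (A := L) hs) (ModuleCat.of R R) (i := i + 1)
      (subsingleton_ext_of_projective P _ i) (subsingleton_ext_of_projective P _ (i + 1))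
    have e₂ := extShiftEquiv (IsSES.deformMap (R' := R') (Q := Q) (A := L) hs).shortExact (ModuleCat.of Q Q)
      (i := c + (i + 1)) (subsingleton_ext_deform_of_projective hc P i)
      (subsingleton_ext_deform_of_projective hc P (i + 1))
    refine e₂.symm.toEquiv.subsingleton_congr.trans ((ih L).trans
      (TensorProduct.congr (LinearEquiv.refl R R') e₁).toEquiv.subsingleton_congr)

end ExtDeform

end Deformation

end ModuleLinkage

namespace ModuleLinkage

/-! ### Linkage over a fixed deformation -/

section Deformation

open scoped TensorProduct

variable {R : Type u} {R' Q : Type u} [CommRing R] [CommRing R'] [CommRing Q] [Algebra R R']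
  [Algebra Q R'] [SMulCommClass R Q R']

/-- The base ring of a deformation as a quotient. -/
noncomputable def equivQuotientOfList (hQ : Function.Surjective (algebraMap Q R')) {rs : List Q}
    (hker : RingHom.ker (algebraMap Q R') = Ideal.ofList rs) :
    R' ≃ₗ[Q] Q ⧸ Ideal.ofList rs :=
  (((Algebra.linearMap Q R').quotKerEquivOfSurjective hQ).symm.trans
    (Submodule.quotEquivOfEq _ _ (by rw [← hker]; rfl)))

lemma projectiveDimension_deformation [IsLocalRing Q] [IsNoetherianRing Q]
    (hQ : Function.Surjective (algebraMap Q R')) {rs : List Q}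
    (hreg : RingTheory.Sequence.IsRegular Q rs)
    (hker : RingHom.ker (algebraMap Q R') = Ideal.ofList rs) :
    projectiveDimension (ModuleCat.of Q R') = rs.length := by
  rw [← ModuleCat.projectiveDimension_quotient_eq_length.{u} rs hreg]
  exact projectiveDimension_eq_of_iso
    ((equivQuotientOfList hQ hker).trans (Shrink.linearEquiv Q _).symm).toModuleIso

/-- The properties of a deformation `Q → R'` of codimension `c`, relative to an algebra
structure `R → R'`, that are used below. -/
structure IsDeformation (R R' Q : Type u) [CommRing R] [CommRing R'] [CommRing Q] [Algebra R R']
    [Algebra Q R'] [SMulCommClass R Q R'] (c : ℕ) : Prop where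
  surjective : Function.Surjective (algebraMap Q R')
  hasProjectiveDimensionLT : HasProjectiveDimensionLT (deform R' Q (ModuleCat.of R R)) (c + 1)
  subsingleton_ext : ∀ (M : ModuleCat.{u} R), ∀ i < c,
    Subsingleton (Ext (deform R' Q M) (ModuleCat.of Q Q) i)
  subsingleton_ext_iff : ∀ (M : ModuleCat.{u} R) [Module.Finite R M] (i : ℕ),
    Subsingleton (Ext (deform R' Q M) (ModuleCat.of Q Q) (c + i)) ↔
      Subsingleton (R' ⊗[R] Ext M (ModuleCat.of R R) i)

variable [Module.Flat R R'] [IsNoetherianRing R]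

/-- The sequence generating the kernel of Q → R' kills every R' ⊗ M, so it yields the duality over
Q, with dualizing object B ≅ Q/(rs) ≅ R'. -/
lemma isDeformation [IsLocalRing Q] [IsNoetherianRing Q]
    (hQ : Function.Surjective (algebraMap Q R')) {rs : List Q}
    (hreg : RingTheory.Sequence.IsRegular Q rs)
    (hker : RingHom.ker (algebraMap Q R') = Ideal.ofList rs) :
    IsDeformation R R' Q rs.length := by
  have hrs : ∀ r ∈ rs, algebraMap Q R' r = 0 := fun r hr => by
    rw [← RingHom.mem_ker, hker]
    exact Ideal.subset_span hr
  have e : (R' ⊗[R] R) ≃ₗ[Q] R' :=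
    (TensorProduct.AlgebraTensorModule.rid R R' R').restrictScalars Q
  have hpd : HasProjectiveDimensionLT (deform R' Q (ModuleCat.of R R)) (rs.length + 1) := by
    have h1 := (projectiveDimension_le_iff _ _).mp (projectiveDimension_deformation hQ hreg hker).le
    exact @hasProjectiveDimensionLT_of_iso _ _ _ _ _ e.symm.toModuleIso _ h1
  have hw : RingTheory.Sequence.IsWeaklyRegular (ModuleCat.of Q Q) rs := hreg.toIsWeaklyRegular
  obtain ⟨B, ⟨eB⟩, ⟨D⟩⟩ := exists_extDuality rs (ModuleCat.of Q Q) hw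
  obtain ⟨_, _, -, hvan⟩ := exists_ext_representing rs (ModuleCat.of Q Q) hw
  have e₂ : (Q ⧸ Ideal.ofList rs) ≃ₗ[Q] Q ⧸ (Ideal.ofList rs • ⊤ : Submodule Q Q) :=
    Submodule.quotEquivOfEq _ _ (by rw [smul_eq_mul, Ideal.mul_top])
  have eB' : deform R' Q (ModuleCat.of R R) ≃ₗ[Q] B :=
    (e.trans (equivQuotientOfList hQ hker)).trans (e₂.trans eB.symm)
  exact ⟨hQ, hpd, fun M => (hvan _ (killedBy_deform hrs M)).1,
    fun M _ i => subsingleton_ext_deform_iff hQ hrs D eB' hpd M i⟩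

variable {c : ℕ} (h : IsDeformation R R' Q c) {n d : ℕ} [IsNoetherianRing Q]
include h

omit [Module.Flat R R'] [IsNoetherianRing R] in
-- If d < n, every Ext_Q^i(R' ⊗ M, Q) vanishes: for i < c by the regular sequence, for c ≤ i < c + n
-- by the grade, and beyond by the dimension bound. Then R' ⊗ M would be zero.
lemma IsDeformation.grade_le {M : ModuleCat.{u} R} [Module.Finite R M] (hM : grade M = n)
    [Nontrivial (R' ⊗[R] M)] (hd : HasProjectiveDimensionLT (deform R' Q M) (d + c + 1)) :
    n ≤ d := by
  by_contra! hdn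
  have := finite_deform h.surjective M
  refine not_subsingleton (R' ⊗[R] M) (subsingleton_of_subsingleton_ext hd fun i => ?_)
  rcases lt_or_ge i c with hi | hi
  · exact h.subsingleton_ext M i hi
  obtain ⟨j, rfl⟩ := Nat.exists_eq_add_of_le hi
  rcases lt_or_ge j n with hj | hj
  · have : Subsingleton (Ext M (ModuleCat.of R R) j) :=
      subsingleton_ext_of_lt_grade (by rw [hM]; exact_mod_cast hj)
    exact (h.subsingleton_ext_iff M j).mpr inferInstance
  · exact HasProjectiveDimensionLT.subsingleton _ (d + c + 1) _ (by omega) _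

lemma IsDeformation.hasProjectiveDimensionLT_of_doublyLinked {M M' : ModuleCat.{u} R}
    (hMM' : DoublyLinked (ModuleCat.of R R) n (perfect n) M M') (hnd : n ≤ d)
    (hd : HasProjectiveDimensionLT (deform R' Q M) (d + c + 1)) :
    HasProjectiveDimensionLT (deform R' Q M') (d + c + 1) := by
  obtain ⟨⟨X, X', φ, φ', hφ, hφ', ⟨e⟩⟩, hext⟩ := hMM'
  have := hφ.finite
  have := hφ'.finite
  have := finite_deform h.surjective M'
  have hX : HasProjectiveDimensionLT (deform R' Q X) (d + c + 1) := by
    have := hφ.source_mem.1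
    have := hasProjectiveDimensionLT_deform h.hasProjectiveDimensionLT
      ((projectiveDimension_le_iff X n).mp hφ.source_mem.2.2.le)
    exact hasProjectiveDimensionLT_of_ge _ (n + c + 1) _ (by omega)
  have hX' : HasProjectiveDimensionLT (deform R' Q X') (d + c + 1) := by
    have := hφ'.source_mem.1
    have := hasProjectiveDimensionLT_deform h.hasProjectiveDimensionLT
      ((projectiveDimension_le_iff X' n).mp hφ'.source_mem.2.2.le)
    exact hasProjectiveDimensionLT_of_ge _ (n + c + 1) _ (by omega)
  have hS := (IsSES.deformMap (R' := R') (Q := Q) (A := ModuleCat.of R (LinearMap.ker φ.hom))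
    (isSES_ker hφ.surjective)).shortExact
  have hS' := (IsSES.deformMap (R' := R') (Q := Q) (A := ModuleCat.of R (LinearMap.ker φ'.hom))
    (isSES_ker hφ'.surjective)).shortExact
  have hk := hS.hasProjectiveDimensionLT_X₁ (d + c + 1) hX
    (hasProjectiveDimensionLT_of_ge _ (d + c + 1) _ (by omega))
  have hk' := @hasProjectiveDimensionLT_of_iso _ _ _ _ _
    (deformEquiv (R' := R') (Q := Q) (M := ModuleCat.of R (LinearMap.ker φ.hom))
      (N := ModuleCat.of R (LinearMap.ker φ'.hom)) e).toModuleIso (d + c + 1) hk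
  have hM' : HasProjectiveDimensionLT (deform R' Q M') (d + c + 1 + 1) :=
    hS'.hasProjectiveDimensionLT_X₃ (d + c + 1) hk'
      (hasProjectiveDimensionLT_of_ge _ (d + c + 1) _ (by omega))
  refine HasProjectiveDimensionLT.of_subsingleton_ext hM' fun i hi => ?_
  -- Write i = c + j; then j > d ≥ n lies in the range where Ext over R is known to agree.
  obtain ⟨j, rfl⟩ := Nat.exists_eq_add_of_le (show c ≤ i by omega)
  obtain ⟨e'⟩ := hext j (by omega)
  refine (h.subsingleton_ext_iff M' j).mpr ?_
  have h1 := (h.subsingleton_ext_iff M j).mp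
    (HasProjectiveDimensionLT.subsingleton _ (d + c + 1) _ (by omega) _)
  exact (TensorProduct.congr (LinearEquiv.refl R R') e'.symm).toEquiv.subsingleton

end Deformation

/-! ### Complete intersection dimension -/

section CI

open scoped TensorProduct

variable {R S : Type u} [CommRing R] [CommRing S] [Algebra R S]

/-- By transitivity of base change, a quasi-deformation of a flat local R-algebra S can be used on
R-modules directly, so linkage need not be localized. Nonvanishing is preserved because the flat
local map S → R' is faithfully flat. -/
lemma QuasiDeformation.exists_isDeformation [IsNoetherianRing R] [IsLocalRing S] [Module.Flat R S]
    (D : QuasiDeformation S) : ∃ (c : ℕ) (_ : Algebra R D.R') (_ : Algebra D.Q D.R')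
      (_ : SMulCommClass R D.Q D.R'), Module.Flat R D.R' ∧ IsDeformation R D.R' D.Q c ∧
      D.pdBase = (c : WithBot ℕ∞) ∧
      ∀ (M : ModuleCat.{u} R) (N : ModuleCat.{u} S) [Module R N] [IsScalarTower R S N]
        (f : M →ₗ[R] N), IsBaseChange S f →
          (D.pd N = projectiveDimension (deform D.R' D.Q M)) ∧
          (Nontrivial N → Nontrivial (D.R' ⊗[R] M)) := by
  let _ : Algebra S D.R' := D.σ.toAlgebra
  let _ : Algebra R D.R' := (D.σ.comp (algebraMap R S)).toAlgebra
  let _ : Algebra D.Q D.R' := D.π.toAlgebra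
  have : IsScalarTower R S D.R' := IsScalarTower.of_algebraMap_eq fun _ => rfl
  have : SMulCommClass R D.Q D.R' := ⟨fun r q x => by
    simp only [Algebra.smul_def]; exact mul_left_comm _ _ _⟩
  have : Module.Flat S D.R' := D.flat_σ
  have : Module.Flat R D.R' := Module.Flat.trans R S D.R'
  have : IsLocalHom (algebraMap S D.R') := D.isLocalHom_σ
  have : Module.FaithfullyFlat S D.R' := Module.FaithfullyFlat.of_flat_of_isLocalHom
  obtain ⟨rs, hreg, hker⟩ := D.exists_regular
  refine ⟨rs.length, inferInstance, inferInstance, inferInstance, inferInstance,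
    isDeformation D.surjective_π hreg hker, ?_, fun M N _ _ f hf => ?_⟩
  · exact projectiveDimension_deformation (Q := D.Q) (R' := D.R') D.surjective_π hreg hker
  · have hcomp := hf.comp (TensorProduct.isBaseChange S N D.R')
    have e : D.R' ⊗[R] M ≃ₗ[D.R'] D.R' ⊗[S] N := hcomp.equiv
    refine ⟨?_, fun hN => ?_⟩
    · exact projectiveDimension_eq_of_iso (e.symm.restrictScalars D.Q).toModuleIso
    · exact e.toEquiv.nontrivial

end CI

end ModuleLinkage

namespace ModuleLinkage

/-! ### Invariance of the complete intersection dimension -/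

section LocalCI

variable {R : Type u} [CommRing R]

/-- The infimum of a nonempty set in ℕ∞ is attained, so one quasi-deformation realizes the bound. -/
lemma localCIDim_le_iff {M : ModuleCat.{u} R} {d : ℕ} :
    localCIDim M ≤ d ↔ ∃ D : QuasiDeformation R, D.pd M ≤ (d : WithBot ℕ∞) + D.pdBase := by
  constructor
  · intro h
    rcases Set.eq_empty_or_nonempty
      {d : ℕ∞ | ∃ D : QuasiDeformation R, D.pd M ≤ (d : WithBot ℕ∞) + D.pdBase} with h0 | h0
    · rw [localCIDim, h0, sInf_empty] at h
      exact absurd (top_le_iff.mp h) (ENat.natCast_ne_top d)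
    · obtain ⟨D, hD⟩ := csInf_mem h0
      refine ⟨D, hD.trans (add_le_add_left ?_ _)⟩
      exact WithBot.coe_le_coe.mpr h
  · rintro ⟨D, hD⟩
    exact sInf_le ⟨D, hD⟩

variable [IsNoetherianRing R] (m : MaximalSpectrum R)

/-- The localization of `M` at a maximal ideal. -/
noncomputable abbrev localizationAt (M : ModuleCat.{u} R) :
    ModuleCat.{u} (Localization.AtPrime m.asIdeal) :=
  ModuleCat.of (Localization.AtPrime m.asIdeal) (LocalizedModule m.asIdeal.primeCompl M)

open scoped TensorProduct

/-- Complete intersection dimension at most `d` at a maximal ideal, in terms of the modules `M`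
over `R`. -/
lemma exists_isDeformation_of_localCIDim_le (M M' : ModuleCat.{u} R) {d : ℕ}
    (h : localCIDim (localizationAt m M) ≤ d) :
    ∃ (R' Q : Type u) (_ : CommRing R') (_ : CommRing Q) (_ : Algebra R R') (_ : Algebra Q R')
      (_ : SMulCommClass R Q R') (c : ℕ), IsNoetherianRing Q ∧ Module.Flat R R' ∧
      IsDeformation R R' Q c ∧
      HasProjectiveDimensionLT (deform R' Q M) (d + c + 1) ∧
      (HasProjectiveDimensionLT (deform R' Q M') (d + c + 1) →
        localCIDim (localizationAt m M') ≤ d) ∧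
      (Nontrivial (LocalizedModule m.asIdeal.primeCompl M) → Nontrivial (R' ⊗[R] M)) := by
  obtain ⟨D, hD⟩ := localCIDim_le_iff.mp h
  obtain ⟨c, i₁, i₂, i₃, hflat, hdef, hc, hM⟩ :=
    D.exists_isDeformation (R := R) (S := Localization.AtPrime m.asIdeal)
  have hb : ∀ N : ModuleCat.{u} R, IsBaseChange (Localization.AtPrime m.asIdeal)
      (LocalizedModule.mkLinearMap m.asIdeal.primeCompl N) := fun N =>
    IsLocalizedModule.isBaseChange m.asIdeal.primeCompl _ _
  have h1 := hM M (localizationAt m M) _ (hb M)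
  have h2 := hM M' (localizationAt m M') _ (hb M')
  have hdc : (d : WithBot ℕ∞) + D.pdBase = ((d + c : ℕ) : WithBot ℕ∞) := by
    rw [hc]; norm_cast
  refine ⟨D.R', D.Q, inferInstance, inferInstance, i₁, i₂, i₃, c, inferInstance, hflat, hdef,
    ?_, fun h => ?_, h1.2⟩
  · rw [h1.1, hdc] at hD
    exact (projectiveDimension_le_iff _ _).mp hD
  · refine localCIDim_le_iff.mpr ⟨D, ?_⟩
    rw [h2.1, hdc]
    exact (projectiveDimension_le_iff _ _).mpr h

lemma DoublyLinked.ciDim_le {n : ℕ} {M M' : ModuleCat.{u} R}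
    (h : DoublyLinked (ModuleCat.of R R) n (perfect n) M M') : ciDim M' ≤ ciDim M := by
  obtain ⟨⟨X, -, φ, -, hφ, -, -⟩, -⟩ := id h
  have := hφ.finite
  have hgr := hφ.grade_eq.trans hφ.source_mem.2.1
  rcases eq_or_ne (ciDim M) ⊤ with htop | htop
  · rw [htop]; exact le_top
  obtain ⟨d, hd⟩ := ENat.ne_top_iff_exists.mp htop
  have hloc : ∀ m, localCIDim (localizationAt m M) ≤ d := fun m => by
    rw [hd]
    exact le_iSup (fun m => localCIDim (localizationAt m M)) m
  -- The grade bound needs a maximal ideal in the support of M, one containing ann M; the inequality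
  -- obtained there then serves at every maximal ideal.
  have hnd : n ≤ d := by
    have hM := nontrivial_of_grade_eq hgr
    obtain ⟨m, hm, hle⟩ := Ideal.exists_le_maximal (Module.annihilator R M)
      (fun htop => not_subsingleton M (Module.annihilator_eq_top_iff.mp htop))
    have hsupp : (⟨m, hm.isPrime⟩ : PrimeSpectrum R) ∈ Module.support R M :=
      Module.mem_support_iff_of_finite.mpr hle
    obtain ⟨R', Q, _, _, _, _, _, c, _, _, hdef, hpd, -, hnt⟩ :=
      exists_isDeformation_of_localCIDim_le ⟨m, hm⟩ M M (hloc ⟨m, hm⟩)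
    have := hnt (Module.mem_support_iff.mp hsupp)
    exact hdef.grade_le hgr hpd
  rw [← hd]
  refine iSup_le fun m => ?_
  -- The quasi-deformation realizing the bound for M is reused for M'.
  obtain ⟨R', Q, _, _, _, _, _, c, _, _, hdef, hpd, hpd', -⟩ :=
    exists_isDeformation_of_localCIDim_le m M M' (hloc m)
  exact hpd' (hdef.hasProjectiveDimensionLT_of_doublyLinked h hnd hpd)

end LocalCI

end ModuleLinkage

theorem mainTheorem7 {R : Type u} [CommRing R] [IsNoetherianRing R] (n : ℕ)
    (M N : ModuleCat.{u} R) [Module.Finite R M] [Module.Finite R N] :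
    (∀ K : ModuleCat.{u} R, ModuleLinkage.IsSemidualizing K →
      ModuleLinkage.SameEvenLiaisonClass K n (ModuleLinkage.gkPerfect K n) M N →
        (∀ i : ℕ, n < i →
          Nonempty (CategoryTheory.Abelian.Ext M K i ≃ₗ[R] CategoryTheory.Abelian.Ext N K i)) ∧
        ModuleLinkage.gkDim K M = ModuleLinkage.gkDim K N) ∧
    (ModuleLinkage.SameEvenLiaisonClass (ModuleCat.of R R) n (ModuleLinkage.perfect n) M N →
        CategoryTheory.projectiveDimension M = CategoryTheory.projectiveDimension N ∧
        ModuleLinkage.ciDim M = ModuleLinkage.ciDim N) := by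
  constructor
  · intro K hK h
    have := hK.finite
    refine h.of_equivalence (P := fun M N =>
      (∀ i : ℕ, n < i → Nonempty (Ext M K i ≃ₗ[R] Ext N K i)) ∧
        ModuleLinkage.gkDim K M = ModuleLinkage.gkDim K N)
      ⟨fun M => ⟨fun i _ => ⟨LinearEquiv.refl R _⟩, rfl⟩,
        fun h => ⟨fun i hi => (h.1 i hi).map LinearEquiv.symm, h.2.symm⟩,
        fun h h' => ⟨fun i hi => Nonempty.map2 LinearEquiv.trans (h.1 i hi) (h'.1 i hi),
          h.2.trans h'.2⟩⟩ fun M N M' h₁ h₂ => ?_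
    have hd := h₁.doublyLinked (ModuleLinkage.gkPerfect_subsingleton_ext hK) h₂
    exact ⟨hd.nonempty_ext_equiv, le_antisymm (hd.symm.gkDim_le hK) (hd.gkDim_le hK)⟩
  · intro h
    have : Module.Finite R (ModuleCat.of R R) := inferInstanceAs (Module.Finite R R)
    refine h.of_equivalence (P := fun M N => projectiveDimension M = projectiveDimension N ∧
        ModuleLinkage.ciDim M = ModuleLinkage.ciDim N)
      ⟨fun M => ⟨rfl, rfl⟩, fun h => ⟨h.1.symm, h.2.symm⟩,
        fun h h' => ⟨h.1.trans h'.1, h.2.trans h'.2⟩⟩ fun M N M' h₁ h₂ => ?_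
    have hd := h₁.doublyLinked ModuleLinkage.perfect_subsingleton_ext h₂
    exact ⟨le_antisymm hd.symm.projectiveDimension_le hd.projectiveDimension_le,
      le_antisymm hd.symm.ciDim_le hd.ciDim_le⟩
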